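/- All spaces are linear spaces of real sequences $x=(x_k)_{k\ge 1}$. For $0<p<\infty$ let $\ell^p$ carry the (quasi-)norm $\|x\|_{\ell^p}=(\sum_k|x_k|^p)^{1/p}$, let $\ell^\infty$ carry $\|x\|_{\ell^\infty}=\sup_k|x_k|$, and let $\ell^0$ be the space of finitely supported sequences with the group quasi-norm $\|x\|_{\ell^0}=\mathrm{card}\{k: x_k\ne 0\}$. A group quasi-norm on a linear space of sequences is a nonnegative functional that vanishes only at $0$, is invariant under $x\mapsto -x$, and satisfies $\|x+y\|\le C(\|x\|+\|y\|)$ for some constant $C$; the space is quasi-Banach if in addition $\|ax\|=|a|\,\|x\|$ for all $a\in\mathbb R$ and the space is complete. For two such spaces $X_0,X_1$, equip $X_0\cap X_1$ with $\max(\|x\|_{X_0},\|x\|_{X_1})$ and $X_0+X_1$ with $\inf\{\|x_0\|_{X_0}+\|x_1\|_{X_1}: x=x_0+x_1,\ x_i\in X_i\}$. Let $\mathrm{Int}(X_0,X_1)$ be the class of all quasi-Banach spaces $X$ such that $X_0\cap X_1\subseteq X\subseteq X_0+X_1$ with continuous inclusions and such that every linear operator $T:X_0+X_1\to X_0+X_1$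 that is bounded on $X_0$ and on $X_1$ is bounded on $X$. Here $T$ is bounded on $Y\subseteq X_0+X_1$ if $T(Y)\subseteq Y$ and there is a constant $C$ with $\|Tx\|_Y\le C\|x\|_Y$ for all $x\in Y$. Theorem. Let $0\le s<p<q<r\le\infty$. Then $$\mathrm{Int}(\ell^p,\ell^q)=\mathrm{Int}(\ell^s,\ell^q)\cap \mathrm{Int}(\ell^p,\ell^r).$$ -/

import Mathlib

open scoped ENNReal

/-- A real linear space of real sequences together with a group quasi-norm on it. Homogeneity and
completeness are not required here (see `QuasiNormedSeqSpace.IsQuasiBanach`), so that `ℓ⁰` is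
included. -/
structure QuasiNormedSeqSpace where
  /-- the underlying linear space of sequences -/
  carrier : Submodule ℝ (ℕ → ℝ)
  /-- the quasi-norm -/
  qnorm : carrier → ℝ
  qnorm_nonneg : ∀ x, 0 ≤ qnorm x
  qnorm_eq_zero_iff : ∀ x, qnorm x = 0 ↔ x = 0
  qnorm_neg : ∀ x, qnorm (-x) = qnorm x
  exists_qnorm_add_le : ∃ C : ℝ, ∀ x y, qnorm (x + y) ≤ C * (qnorm x + qnorm y)

namespace QuasiNormedSeqSpace

/-- `X` is a quasi-Banach space: its quasi-norm is homogeneous and `X` is complete. -/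
def IsQuasiBanach (X : QuasiNormedSeqSpace) : Prop :=
  (∀ (a : ℝ) (x : X.carrier), X.qnorm (a • x) = |a| * X.qnorm x) ∧
  ∀ u : ℕ → X.carrier,
    (∀ ε : ℝ, 0 < ε → ∃ N : ℕ, ∀ m n : ℕ, N ≤ m → N ≤ n → X.qnorm (u m - u n) < ε) →
    ∃ x : X.carrier, Filter.Tendsto (fun n => X.qnorm (u n - x)) Filter.atTop (nhds 0)

/-- The underlying linear space of `X₀ + X₁`. -/
def sumCarrier (X₀ X₁ : QuasiNormedSeqSpace) : Submodule ℝ (ℕ → ℝ) :=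
  X₀.carrier ⊔ X₁.carrier

/-- The quasi-norm of `X₀ + X₁`:
`‖x‖ = inf {‖x₀‖ + ‖x₁‖ : x = x₀ + x₁, xᵢ ∈ Xᵢ}`. -/
noncomputable def sumNorm (X₀ X₁ : QuasiNormedSeqSpace) (x : sumCarrier X₀ X₁) : ℝ :=
  sInf {c : ℝ | ∃ (x₀ : X₀.carrier) (x₁ : X₁.carrier),
    (x : ℕ → ℝ) = (x₀ : ℕ → ℝ) + (x₁ : ℕ → ℝ) ∧ c = X₀.qnorm x₀ + X₁.qnorm x₁}

/-- The underlying linear space of `X₀ ∩ X₁`. -/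
def interCarrier (X₀ X₁ : QuasiNormedSeqSpace) : Submodule ℝ (ℕ → ℝ) :=
  X₀.carrier ⊓ X₁.carrier

/-- The quasi-norm of `X₀ ∩ X₁`: `‖x‖ = max (‖x‖_{X₀}) (‖x‖_{X₁})`. -/
noncomputable def interNorm (X₀ X₁ : QuasiNormedSeqSpace) (x : interCarrier X₀ X₁) : ℝ :=
  max (X₀.qnorm ⟨x, x.2.1⟩) (X₁.qnorm ⟨x, x.2.2⟩)

/-- `X` is intermediate between `X₀` and `X₁`: it is a quasi-Banach space, and there are
continuous inclusions `X₀ ∩ X₁ ⊆ X ⊆ X₀ + X₁`. Continuity refers to the topologies given by the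
quasi-norms; for additive maps it is continuity at `0`. -/
def IsIntermediate (X₀ X₁ X : QuasiNormedSeqSpace) : Prop :=
  X.IsQuasiBanach ∧
  (∃ h : interCarrier X₀ X₁ ≤ X.carrier, ∀ ε : ℝ, 0 < ε → ∃ δ : ℝ, 0 < δ ∧
    ∀ x : interCarrier X₀ X₁, interNorm X₀ X₁ x < δ → X.qnorm ⟨x, h x.2⟩ < ε) ∧
  (∃ h : X.carrier ≤ sumCarrier X₀ X₁, ∀ ε : ℝ, 0 < ε → ∃ δ : ℝ, 0 < δ ∧
    ∀ x : X.carrier, X.qnorm x < δ → sumNorm X₀ X₁ ⟨x, h x.2⟩ < ε)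

/-- A linear operator `T : V → V` on a space of sequences is bounded on `X` (used for
`X ⊆ V`): it maps `X` to `X`, and `‖T x‖_X ≤ C ‖x‖_X` for all `x ∈ X`. -/
def IsBoundedOn {V : Submodule ℝ (ℕ → ℝ)} (T : V →ₗ[ℝ] V) (X : QuasiNormedSeqSpace) : Prop :=
  ∃ C : ℝ, ∀ (x : ℕ → ℝ) (hV : x ∈ V) (hX : x ∈ X.carrier),
    ∃ h : (T ⟨x, hV⟩ : ℕ → ℝ) ∈ X.carrier, X.qnorm ⟨T ⟨x, hV⟩, h⟩ ≤ C * X.qnorm ⟨x, hX⟩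

/-- The class `Int(X₀, X₁)` of interpolation spaces: the intermediate quasi-Banach spaces `X` on
which every linear operator on `X₀ + X₁` that is bounded on `X₀` and on `X₁` is bounded. -/
def Int (X₀ X₁ : QuasiNormedSeqSpace) : Set QuasiNormedSeqSpace :=
  {X | IsIntermediate X₀ X₁ X ∧
    ∀ T : sumCarrier X₀ X₁ →ₗ[ℝ] sumCarrier X₀ X₁,
      IsBoundedOn T X₀ → IsBoundedOn T X₁ → IsBoundedOn T X}

end QuasiNormedSeqSpace

theorem lp_exists_norm_add_le (p : ℝ≥0∞) :
    ∃ C : ℝ, ∀ x y : lp (fun _ : ℕ => ℝ) p, ‖x + y‖ ≤ C * (‖x‖ + ‖y‖) := by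
  rcases eq_or_ne p 0 with rfl | hp0
  · refine ⟨1, fun x y => ?_⟩
    rw [one_mul, lp.norm_eq_card_dsupport, lp.norm_eq_card_dsupport, lp.norm_eq_card_dsupport]
    classical
    rw [← Nat.cast_add]
    refine Nat.cast_le.mpr (le_trans (Finset.card_le_card ?_) (Finset.card_union_le _ _))
    intro i hi
    simp only [Set.Finite.mem_toFinset, Set.mem_ofPred_eq, Finset.mem_union, lp.coeFn_add,
      Pi.add_apply] at hi ⊢
    by_contra hcon
    push Not at hcon
    exact hi (by rw [hcon.1, hcon.2, add_zero])
  rcases le_or_gt 1 p with hp1 | hp1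
  · haveI : Fact (1 ≤ p) := ⟨hp1⟩
    exact ⟨1, fun x y => by rw [one_mul]; exact norm_add_le x y⟩
  have hptop : p ≠ ∞ := (hp1.trans ENNReal.one_lt_top).ne
  have hpos : 0 < p.toReal := ENNReal.toReal_pos hp0 hptop
  have hle : p.toReal ≤ 1 := by
    have := ENNReal.toReal_mono ENNReal.one_ne_top hp1.le
    simpa using this
  refine ⟨2 ^ (1 / p.toReal), fun x y => ?_⟩
  have hnn : ∀ z : lp (fun _ : ℕ => ℝ) p, 0 ≤ ‖z‖ := fun z => lp.norm_nonneg' z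
  set M := ‖x‖ + ‖y‖ with hM
  have hM0 : 0 ≤ M := add_nonneg (hnn x) (hnn y)
  have key : ‖x + y‖ ^ p.toReal ≤ 2 * M ^ p.toReal := by
    have hx := lp.hasSum_norm hpos x
    have hy := lp.hasSum_norm hpos y
    have hxy := lp.hasSum_norm hpos (x + y)
    have h1 : ‖x + y‖ ^ p.toReal ≤ ‖x‖ ^ p.toReal + ‖y‖ ^ p.toReal := by
      refine hasSum_le (fun i => ?_) hxy (hx.add hy)
      refine le_trans (Real.rpow_le_rpow (norm_nonneg _) (norm_add_le (x i) (y i)) hpos.le) ?_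
      exact Real.rpow_add_le_add_rpow (norm_nonneg _) (norm_nonneg _) hpos.le hle
    have h2 : ‖x‖ ^ p.toReal ≤ M ^ p.toReal :=
      Real.rpow_le_rpow (hnn x) (by linarith [hnn y]) hpos.le
    have h3 : ‖y‖ ^ p.toReal ≤ M ^ p.toReal :=
      Real.rpow_le_rpow (hnn y) (by linarith [hnn x]) hpos.le
    linarith
  have h4 := Real.rpow_le_rpow (Real.rpow_nonneg (hnn (x + y)) _) key
    (one_div_nonneg.mpr hpos.le)
  rw [Real.mul_rpow (by norm_num) (Real.rpow_nonneg hM0 _), ← Real.rpow_mul (hnn _),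
    ← Real.rpow_mul hM0, mul_one_div_cancel hpos.ne', Real.rpow_one, Real.rpow_one] at h4
  exact h4

/-- The real sequence space `ℓᵖ`, `0 ≤ p ≤ ∞`, with Mathlib's `‖·‖_{ℓᵖ}`: the number of non-zero
terms for `p = 0` (on the sequences with finite support), `(∑ |x_k|ᵖ)^{1/p}` for `0 < p < ∞`, and
`sup |x_k|` for `p = ∞`. -/
noncomputable def ell (p : ℝ≥0∞) : QuasiNormedSeqSpace where
  carrier :=
    { carrier := {x | Memℓp x p}
      add_mem' := fun hx hy => hx.add hy
      zero_mem' := zero_memℓp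
      smul_mem' := fun c _ hx => hx.const_smul c }
  qnorm x := ‖(⟨x.1, x.2⟩ : lp (fun _ : ℕ => ℝ) p)‖
  qnorm_nonneg _ := lp.norm_nonneg' _
  qnorm_eq_zero_iff x := by
    rw [lp.norm_eq_zero_iff, Subtype.ext_iff, Subtype.ext_iff]
    rfl
  qnorm_neg x := lp.norm_neg (f := (⟨x.1, x.2⟩ : lp (fun _ : ℕ => ℝ) p))
  exists_qnorm_add_le := by
    obtain ⟨C, hC⟩ := lp_exists_norm_add_le p
    exact ⟨C, fun x y => hC ⟨x.1, x.2⟩ ⟨y.1, y.2⟩⟩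

/-! An operator `T` bounded on `ℓ^p` and `ℓ^q` acts at each single point as a sum of two kinds of
operators. One kind is harmless on every `ℓ^t` with `t ≥ p`, the other on every `ℓ^t` with `t ≤ q`.
Precisely, for `x ∈ ℓ^q` one has `T x = K (S₁ x + D x + S₂ x)`, where `S₁`, `D`, `S₂` depend on `x`
but `K` does not (`exists_contractions_of_mapsBdd`). If `X` lies in both classes on the right, `S₁`
preserves `X` because it is bounded on `ℓ^p` and `ℓ^r`, while `D` and `S₂` preserve it because they
are bounded on `ℓ^s` and `ℓ^q`. Hence `T` maps `X` to itself, and the closed graph theorem makes it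
bounded (`exists_mapsBdd_of_mapsTo`).

To obtain the decomposition, rearrange `x` and `y = T x` decreasingly to `x*` and `y*`. Cutting `x`
after its `n` largest entries splits `y` into a part small in `ℓ^p` and a part small in `ℓ^q`. So
for each `n` either the head of `y*` is controlled in `ℓ^p` by the head of `x*`, or the tail of `y*`
in `ℓ^q` by the tail of `x*` (`head_or_tail_le`). On the indices of the first sort, entries of `y*`
are packed into entries of `x*`, each used with total weight at most one in `ℓ^p`
(`exists_head_operator`). On the others, an entry of `y*` either is dominated by that of `x*` or is
a norming functional on one of several disjoint groups of entries of `x*` (`exists_tail_operator`).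

The opposite inclusion is interpolation of operators. It follows from the same decomposition, whose
pieces are contractions of the intermediate `ℓ^t`; for `ℓ⁰` one first tests on unit vectors. -/

/-! ### Boundedness on `ℓ^t` through sums of powers. -/

/-- The `t`-th power of the `ℓᵗ` quasi-norm, with values in `[0, ∞]`. -/
noncomputable def pw (t : ℝ) (z : ℕ → ℝ) : ℝ≥0∞ := ∑' k, ‖z k‖ₑ ^ t

/-- `T` maps `X` to itself with constant `C`. -/
def MapsBdd (T : (ℕ → ℝ) →ₗ[ℝ] (ℕ → ℝ)) (X : QuasiNormedSeqSpace) (C : ℝ) : Prop :=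
  ∀ (x : ℕ → ℝ) (hx : x ∈ X.carrier),
    ∃ h : T x ∈ X.carrier, X.qnorm ⟨T x, h⟩ ≤ C * X.qnorm ⟨x, hx⟩

theorem mem_ell {t : ℝ≥0∞} {z : ℕ → ℝ} : z ∈ (ell t).carrier ↔ Memℓp z t := Iff.rfl

theorem enorm_rpow_eq_ofReal {t : ℝ} (ht : 0 < t) (a : ℝ) :
    ‖a‖ₑ ^ t = ENNReal.ofReal (|a| ^ t) := by
  rw [← ofReal_norm, ENNReal.ofReal_rpow_of_nonneg (norm_nonneg _) ht.le, Real.norm_eq_abs]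

theorem pw_ne_top_iff_summable {t : ℝ} (ht : 0 < t) {z : ℕ → ℝ} :
    pw t z ≠ ⊤ ↔ Summable fun k => |z k| ^ t := by
  unfold pw
  simp_rw [enorm_rpow_eq_ofReal ht]
  constructor
  · intro h
    have := ENNReal.summable_toReal h
    refine this.congr fun k => ?_
    rw [ENNReal.toReal_ofReal (by positivity)]
  · intro h
    exact h.tsum_ofReal_ne_top

theorem pw_eq_ofReal_tsum {t : ℝ} (ht : 0 < t) {z : ℕ → ℝ} (h : pw t z ≠ ⊤) :
    pw t z = ENNReal.ofReal (∑' k, |z k| ^ t) := by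
  rw [ENNReal.ofReal_tsum_of_nonneg (fun _ => by positivity) ((pw_ne_top_iff_summable ht).1 h)]
  exact tsum_congr fun k => enorm_rpow_eq_ofReal ht _

theorem mem_ell_iff_pw {t : ℝ≥0∞} (ht0 : 0 < t) (ht : t ≠ ⊤) {z : ℕ → ℝ} :
    z ∈ (ell t).carrier ↔ pw t.toReal z ≠ ⊤ := by
  have h := ENNReal.toReal_pos ht0.ne' ht
  rw [mem_ell, memℓp_gen_iff h, pw_ne_top_iff_summable h]
  rfl

theorem ell_qnorm_rpow {t : ℝ≥0∞} (ht0 : 0 < t) (ht : t ≠ ⊤) {z : ℕ → ℝ}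
    (hz : z ∈ (ell t).carrier) :
    (ell t).qnorm ⟨z, hz⟩ ^ t.toReal = (pw t.toReal z).toReal := by
  have h := ENNReal.toReal_pos ht0.ne' ht
  rw [pw_eq_ofReal_tsum h ((mem_ell_iff_pw ht0 ht).1 hz),
    ENNReal.toReal_ofReal (tsum_nonneg fun _ => by positivity)]
  exact lp.norm_rpow_eq_tsum h _

theorem ell_qnorm_le_iff {t : ℝ≥0∞} (ht0 : 0 < t) (ht : t ≠ ⊤) {z : ℕ → ℝ}
    (hz : z ∈ (ell t).carrier) {M : ℝ} (hM : 0 ≤ M) :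
    (ell t).qnorm ⟨z, hz⟩ ≤ M ↔ pw t.toReal z ≤ ENNReal.ofReal (M ^ t.toReal) := by
  have h := ENNReal.toReal_pos ht0.ne' ht
  rw [← Real.rpow_le_rpow_iff ((ell t).qnorm_nonneg _) hM h, ell_qnorm_rpow ht0 ht hz,
    ENNReal.le_ofReal_iff_toReal_le ((mem_ell_iff_pw ht0 ht).1 hz) (by positivity)]

theorem mapsBdd_of_pw_le {t : ℝ≥0∞} (ht0 : 0 < t) (ht : t ≠ ⊤) {T : (ℕ → ℝ) →ₗ[ℝ] (ℕ → ℝ)}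
    {c : ℝ≥0∞} (hc : c ≠ ⊤)
    (h : ∀ z, pw t.toReal z ≠ ⊤ → pw t.toReal (T z) ≤ c * pw t.toReal z) :
    MapsBdd T (ell t) (c.toReal ^ (1 / t.toReal)) := by
  intro x hx
  have hpos := ENNReal.toReal_pos ht0.ne' ht
  have hx' := (mem_ell_iff_pw ht0 ht).1 hx
  have hle := h x hx'
  have hT : T x ∈ (ell t).carrier :=
    (mem_ell_iff_pw ht0 ht).2 (ne_top_of_le_ne_top (ENNReal.mul_ne_top hc hx') hle)
  refine ⟨hT, ?_⟩
  have hn := (ell t).qnorm_nonneg ⟨x, hx⟩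
  rw [ell_qnorm_le_iff ht0 ht hT (by positivity), Real.mul_rpow (by positivity) hn,
    ← Real.rpow_mul (by positivity), one_div_mul_cancel hpos.ne', Real.rpow_one,
    ell_qnorm_rpow ht0 ht hx, ← ENNReal.toReal_mul, ENNReal.ofReal_toReal]
  · exact hle
  · exact ENNReal.mul_ne_top hc hx'

theorem MapsBdd.exists_pw_le {t : ℝ≥0∞} (ht0 : 0 < t) (ht : t ≠ ⊤) {T : (ℕ → ℝ) →ₗ[ℝ] (ℕ → ℝ)}
    {C : ℝ} (h : MapsBdd T (ell t) C) :
    ∃ c : ℝ, 1 ≤ c ∧ ∀ z, pw t.toReal (T z) ≤ ENNReal.ofReal c * pw t.toReal z := by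
  have hpos := ENNReal.toReal_pos ht0.ne' ht
  have h1 : 1 ≤ (max C 1) ^ t.toReal := Real.one_le_rpow (le_max_right _ _) hpos.le
  refine ⟨(max C 1) ^ t.toReal, h1, fun z => ?_⟩
  by_cases hz : pw t.toReal z = ⊤
  · rw [hz, ENNReal.mul_top]
    · exact le_top
    · exact (ENNReal.ofReal_pos.2 (by linarith)).ne'
  have hz' := (mem_ell_iff_pw ht0 ht).2 hz
  obtain ⟨hT, hle⟩ := h z hz'
  have hn := (ell t).qnorm_nonneg ⟨z, hz'⟩
  have hm : (0 : ℝ) ≤ max C 1 := zero_le_one.trans (le_max_right _ _)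
  have h2 : (ell t).qnorm ⟨T z, hT⟩ ≤ max C 1 * (ell t).qnorm ⟨z, hz'⟩ :=
    hle.trans (mul_le_mul_of_nonneg_right (le_max_left _ _) hn)
  rw [ell_qnorm_le_iff ht0 ht hT (by positivity), Real.mul_rpow hm hn, ell_qnorm_rpow ht0 ht hz',
    ENNReal.ofReal_mul (by positivity), ENNReal.ofReal_toReal hz] at h2
  exact h2

theorem mapsBdd_top_of_forall {T : (ℕ → ℝ) →ₗ[ℝ] (ℕ → ℝ)} {C : ℝ}
    (h : ∀ (z : ℕ → ℝ) (M : ℝ), (∀ k, |z k| ≤ M) → ∀ k, |T z k| ≤ C * M) :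
    MapsBdd T (ell ⊤) C := by
  intro x hx
  have h1 : ∀ k, |x k| ≤ (ell ⊤).qnorm ⟨x, hx⟩ :=
    fun k => lp.norm_apply_le_norm ENNReal.top_ne_zero (⟨x, hx⟩ : lp (fun _ : ℕ => ℝ) ⊤) k
  have h2 := h x _ h1
  have hT : T x ∈ (ell ⊤).carrier :=
    memℓp_infty ⟨C * (ell ⊤).qnorm ⟨x, hx⟩, by rintro _ ⟨k, rfl⟩; exact h2 k⟩
  exact ⟨hT, lp.norm_le_of_forall_le' (f := (⟨T x, hT⟩ : lp (fun _ : ℕ => ℝ) ⊤)) _ h2⟩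

theorem MapsBdd.top_apply_le {T : (ℕ → ℝ) →ₗ[ℝ] (ℕ → ℝ)} {C : ℝ} (hC : 0 ≤ C)
    (h : MapsBdd T (ell ⊤) C) (z : ℕ → ℝ) (M : ℝ) (hz : ∀ k, |z k| ≤ M) (k : ℕ) :
    |T z k| ≤ C * M := by
  have hz' : z ∈ (ell ⊤).carrier := memℓp_infty ⟨M, by rintro _ ⟨k, rfl⟩; exact hz k⟩
  obtain ⟨hT, hle⟩ := h z hz'
  have h1 : |T z k| ≤ (ell ⊤).qnorm ⟨T z, hT⟩ :=
    lp.norm_apply_le_norm ENNReal.top_ne_zero (⟨T z, hT⟩ : lp (fun _ : ℕ => ℝ) ⊤) k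
  have h2 : (ell ⊤).qnorm ⟨z, hz'⟩ ≤ M :=
    lp.norm_le_of_forall_le' (f := (⟨z, hz'⟩ : lp (fun _ : ℕ => ℝ) ⊤)) _ hz
  exact h1.trans (hle.trans (mul_le_mul_of_nonneg_left h2 hC))

theorem ell_zero_qnorm {z : ℕ → ℝ} (hz : z ∈ (ell 0).carrier) :
    (ell 0).qnorm ⟨z, hz⟩ = ({k | z k ≠ 0} : Set ℕ).ncard := by
  refine (lp.norm_eq_card_dsupport (⟨z, hz⟩ : lp (fun _ : ℕ => ℝ) 0)).trans ?_
  rw [Set.ncard_eq_toFinset_card _ (memℓp_zero_iff.1 hz)]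

theorem mapsBdd_zero_of_card {T : (ℕ → ℝ) →ₗ[ℝ] (ℕ → ℝ)}
    (h : ∀ z : ℕ → ℝ, ∃ φ : ℕ → ℕ, Set.InjOn φ {k | T z k ≠ 0} ∧ ∀ k, T z k ≠ 0 → z (φ k) ≠ 0) :
    MapsBdd T (ell 0) 1 := by
  intro x hx
  obtain ⟨φ, hφ, hφ'⟩ := h x
  have hfin : ({k | x k ≠ 0} : Set ℕ).Finite := memℓp_zero_iff.1 hx
  have hmaps : Set.MapsTo φ {k | T x k ≠ 0} {k | x k ≠ 0} := hφ'
  have hT : T x ∈ (ell 0).carrier := memℓp_zero (hfin.of_injOn hmaps hφ)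
  refine ⟨hT, ?_⟩
  rw [ell_zero_qnorm, ell_zero_qnorm, one_mul]
  exact_mod_cast Set.ncard_le_ncard_of_injOn φ hmaps hφ hfin

theorem MapsBdd.comp {S T : (ℕ → ℝ) →ₗ[ℝ] (ℕ → ℝ)} {X : QuasiNormedSeqSpace}
    (hS : MapsBdd S X 1) (hT : MapsBdd T X 1) : MapsBdd (S ∘ₗ T) X 1 := by
  intro x hx
  obtain ⟨h1, h1'⟩ := hT x hx
  obtain ⟨h2, h2'⟩ := hS _ h1
  exact ⟨h2, by rw [one_mul] at *; exact h2'.trans h1'⟩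

theorem pw_le_iff_sum {t : ℝ} {z : ℕ → ℝ} {c : ℝ≥0∞} :
    pw t z ≤ c ↔ ∀ F : Finset ℕ, ∑ k ∈ F, ‖z k‖ₑ ^ t ≤ c := by
  unfold pw
  rw [ENNReal.tsum_eq_iSup_sum, iSup_le_iff]

/-! ### Combinatorics of decreasing sequences: rearrangement, packing, grouping. -/

/-- Decreasing rearrangement of a null sequence. -/
theorem exists_antitone_rearrangement {x : ℕ → ℝ}
    (hx : Filter.Tendsto x Filter.atTop (nhds 0)) :
    ∃ σ : ℕ → ℕ, Function.Injective σ ∧ Antitone (fun n => |x (σ n)|) ∧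
      ∀ k, x k ≠ 0 → k ∈ Set.range σ := by
  have hlarge : ∀ a : ℝ, 0 < a → {k | a ≤ |x k|}.Finite := by
    intro a ha
    have h := (hx.abs.eventually (gt_mem_nhds (show |(0 : ℝ)| < a by simpa using ha)))
    rw [← Nat.cofinite_eq_atTop, Filter.eventually_cofinite] at h
    simpa using h
  have hmax : ∀ F : Finset ℕ, ∃ m, m ∉ F ∧ ∀ k, k ∉ F → |x k| ≤ |x m| := by
    intro F
    by_cases h0 : ∃ k, k ∉ F ∧ x k ≠ 0
    · obtain ⟨k₀, hk₀, hxk⟩ := h0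
      have hfin : ({k | |x k₀| ≤ |x k|} \ (F : Set ℕ)).Finite :=
        (hlarge _ (abs_pos.2 hxk)).subset Set.sdiff_subset
      obtain ⟨m, hm, hm'⟩ := hfin.exists_maximalFor (fun k => |x k|) _
        ⟨k₀, by simp [hk₀]⟩
      refine ⟨m, hm.2, fun k hk => ?_⟩
      by_contra! hlt
      have := hm' (j := k) ⟨hm.1.trans hlt.le, hk⟩ hlt.le
      exact absurd this (not_le.2 hlt)
    -- Once only zeros remain, any unused index is a maximum.
    · push Not at h0
      obtain ⟨m, hm⟩ := Infinite.exists_notMem_finset F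
      exact ⟨m, hm, fun k hk => by rw [h0 k hk, h0 m hm]⟩
  choose g hg hg' using hmax
  obtain ⟨σ, hσ⟩ : ∃ σ : ℕ → ℕ, ∀ n, σ n = g ((Finset.range n).image σ) := by
    let s : ℕ → Finset ℕ := fun n => Nat.rec ∅ (fun _ F => insert (g F) F) n
    have hs : ∀ n, s n = (Finset.range n).image fun n => g (s n) := by
      intro n
      induction n with
      | zero => rfl
      | succ n ih =>
        rw [Finset.range_add_one, Finset.image_insert, ← ih]
    exact ⟨fun n => g (s n), fun n => congrArg g (hs n)⟩
  have hnot : ∀ m n, m < n → σ m ≠ σ n := by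
    intro m n hmn h
    refine hg ((Finset.range n).image σ) ?_
    rw [← hσ n, ← h]
    exact Finset.mem_image_of_mem _ (Finset.mem_range.2 hmn)
  have hinj : Function.Injective σ := by
    intro m n h
    rcases lt_trichotomy m n with h1 | h1 | h1
    · exact absurd h (hnot m n h1)
    · exact h1
    · exact absurd h.symm (hnot n m h1)
  refine ⟨σ, hinj, antitone_nat_of_succ_le fun n => ?_, fun k hk => ?_⟩
  · have h := hg' ((Finset.range n).image σ) (σ (n + 1)) ?_
    · rwa [← hσ n] at h
    · intro hmem
      obtain ⟨m, hm, hme⟩ := Finset.mem_image.1 hmem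
      exact hnot m (n + 1) (by have := Finset.mem_range.1 hm; omega) hme
  -- If `k` were never chosen, infinitely many entries would be at least `|x k| > 0`, against `x →
  -- 0`.
  · by_contra hcon
    have hle : ∀ n, σ n ∈ {j | |x k| ≤ |x j|} := by
      intro n
      have h := hg' ((Finset.range n).image σ) k ?_
      · rwa [← hσ n] at h
      · intro hmem
        obtain ⟨m, -, hme⟩ := Finset.mem_image.1 hmem
        exact hcon ⟨m, hme⟩
    exact Set.infinite_of_injective_forall_mem hinj hle (hlarge _ (abs_pos.2 hk))

/-- If the partial sums of `b` are bounded by those of `a`, the items `b k` can be packed into the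
bins `a j` with `j < k`, at the cost of doubling the bins. -/
theorem exists_bin_packing {a b : ℕ → ℝ} (ha : ∀ k, 0 ≤ a k) (hb : ∀ k, 0 ≤ b k)
    (hba : ∀ j k, j < k → 0 < a j → b k ≤ a j) (hdisj : ∀ k, 0 < b k → a k = 0)
    (hsum : ∀ n, ∑ k ∈ Finset.range n, b k ≤ ∑ k ∈ Finset.range n, a k) :
    ∃ m : ℕ → ℕ, (∀ k, 0 < b k → 0 < a (m k) ∧ m k < k) ∧
      ∀ (j : ℕ) (F : Finset ℕ), (∀ k ∈ F, 0 < b k ∧ m k = j) → ∑ k ∈ F, b k ≤ 2 * a j := by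
  classical
  set B : ℕ → ℝ := fun n => ∑ k ∈ Finset.range n, b k with hB
  set A : ℕ → ℝ := fun n => ∑ k ∈ Finset.range n, a k with hA
  have hBs : ∀ n, B (n + 1) = B n + b n := fun n => Finset.sum_range_succ _ _
  have hAs : ∀ n, A (n + 1) = A n + a n := fun n => Finset.sum_range_succ _ _
  have hBm : Monotone B := monotone_nat_of_le_succ fun n => by rw [hBs]; linarith [hb n]
  have hex : ∀ k, 0 < b k → ∃ j, B k < A (j + 1) := by
    intro k hk
    refine ⟨k, ?_⟩
    have := hsum (k + 1)
    change B (k + 1) ≤ A (k + 1) at this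
    rw [hBs] at this
    linarith
  -- Item `k` occupies `[B k, B (k + 1))` on the line and goes to the bin `[A m, A (m + 1))`
  -- containing its left endpoint. Since `a k = 0`, the bound `B (k + 1) ≤ A (k + 1) = A k` gives `m
  -- < k`.
  have hm : ∀ k, ∃ m, 0 < b k → A m ≤ B k ∧ B k < A (m + 1) ∧ m < k := by
    intro k
    by_cases hk : 0 < b k
    · refine ⟨Nat.find (hex k hk), fun _ => ⟨?_, Nat.find_spec (hex k hk), ?_⟩⟩
      · rcases Nat.eq_zero_or_pos (Nat.find (hex k hk)) with h0 | h0
        · rw [h0]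
          simpa [A] using Finset.sum_nonneg fun i _ => hb i
        · have := Nat.find_min (hex k hk) (m := Nat.find (hex k hk) - 1) (by omega)
          rw [Nat.sub_add_cancel h0] at this
          exact not_lt.1 this
      · have h1 := hsum (k + 1)
        change B (k + 1) ≤ A (k + 1) at h1
        rw [hBs, hAs, hdisj k hk] at h1
        have hk0 : k ≠ 0 := by
          rintro rfl
          simp [A, B] at h1
          linarith
        obtain ⟨i, rfl⟩ := Nat.exists_eq_succ_of_ne_zero hk0
        have : Nat.find (hex (i + 1) hk) ≤ i := Nat.find_min' _ (by
          change B (i + 1) + b (i + 1) ≤ A (i + 1) + 0 at h1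
          change 0 < b (i + 1) at hk
          linarith)
        change Nat.find (hex (i + 1) hk) < i + 1
        omega
    · exact ⟨0, fun h => absurd h hk⟩
  choose m hm using hm
  have hpos : ∀ k, 0 < b k → 0 < a (m k) := by
    intro k hk
    obtain ⟨h1, h2, -⟩ := hm k hk
    rw [hAs] at h2
    linarith
  refine ⟨m, fun k hk => ⟨hpos k hk, (hm k hk).2.2⟩, fun j F hF => ?_⟩
  rcases F.eq_empty_or_nonempty with rfl | hne
  · simpa using ha j
  set k₀ := F.min' hne
  set k₁ := F.max' hne
  have hk₀ := hF k₀ (F.min'_mem hne)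
  have hk₁ := hF k₁ (F.max'_mem hne)
  -- All items of bin `j` but the last fit between `A j` and `A (j + 1)`; the last adds at most `a
  -- j`, whence the factor 2.
  have h1 : ∑ k ∈ F, b k ≤ ∑ k ∈ Finset.Ico k₀ (k₁ + 1), b k := by
    refine Finset.sum_le_sum_of_subset_of_nonneg (fun k hk => ?_) fun i _ _ => hb i
    exact Finset.mem_Ico.2 ⟨F.min'_le k hk, Nat.lt_succ_of_le (F.le_max' k hk)⟩
  have h01 : k₀ ≤ k₁ := F.min'_le _ (F.max'_mem hne)
  rw [Finset.sum_Ico_eq_sub _ (by omega)] at h1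
  change _ ≤ B (k₁ + 1) - B k₀ at h1
  rw [hBs] at h1
  have e0 := hm k₀ hk₀.1
  have e1 := hm k₁ hk₁.1
  rw [hk₀.2] at e0
  rw [hk₁.2, hAs] at e1
  have e2 := hba j k₁ e1.2.2 (by have := hpos k₁ hk₁.1; rwa [hk₁.2] at this)
  linarith

/-- An item with `4 * b k ≤ a k` stays in its own bin. The others, enlarged to `4 * b k`, are packed
into the bins of the former sort; discarding the small bins costs at most `4 * ∑ b`, which with the
enlargement explains the 8. A bin then holds at most `a j / 4 + a j / 2`. -/
theorem exists_head_packing {a b : ℕ → ℝ} (ha : ∀ k, 0 ≤ a k) (hb : ∀ k, 0 ≤ b k)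
    (hanti : Antitone b) (A : Set ℕ)
    (hA : ∀ n ∈ A, 8 * ∑ k ∈ Finset.range (n + 1), b k ≤ ∑ k ∈ Finset.range (n + 1), a k) :
    ∃ m : ℕ → ℕ, (∀ k ∈ A, b k ≤ a (m k)) ∧
      ∀ (j : ℕ) (F : Finset ℕ), (∀ k ∈ F, k ∈ A ∧ m k = j) → ∑ k ∈ F, b k ≤ a j := by
  classical
  set a' : ℕ → ℝ := fun k => if 4 * b k ≤ a k then a k else 0 with ha'
  set b' : ℕ → ℝ := fun k => if k ∈ A ∧ ¬ (4 * b k ≤ a k) then 4 * b k else 0 with hb'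
  have ha'0 : ∀ k, 0 ≤ a' k := fun k => by simp only [ha']; split_ifs; exacts [ha k, le_rfl]
  have hb'0 : ∀ k, 0 ≤ b' k := fun k => by
    simp only [hb']; split_ifs; exacts [by linarith [hb k], le_rfl]
  have hb'le : ∀ k, b' k ≤ 4 * b k := fun k => by
    simp only [hb']; split_ifs; exacts [le_rfl, by linarith [hb k]]
  have hmemA : ∀ n ∈ A, ∑ k ∈ Finset.range (n + 1), b' k ≤ ∑ k ∈ Finset.range (n + 1), a' k := by
    intro n hn
    have h1 : ∑ k ∈ Finset.range (n + 1), b' k ≤ 4 * ∑ k ∈ Finset.range (n + 1), b k := by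
      rw [Finset.mul_sum]; exact Finset.sum_le_sum fun k _ => hb'le k
    have h2 : ∑ k ∈ Finset.range (n + 1), a k ≤
        ∑ k ∈ Finset.range (n + 1), a' k + 4 * ∑ k ∈ Finset.range (n + 1), b k := by
      rw [Finset.mul_sum, ← Finset.sum_add_distrib]
      refine Finset.sum_le_sum fun k _ => ?_
      simp only [ha']
      split_ifs with h <;> linarith [hb k]
    linarith [hA n hn]
  have hsum : ∀ n, ∑ k ∈ Finset.range n, b' k ≤ ∑ k ∈ Finset.range n, a' k := by
    intro n
    induction n with
    | zero => simp
    | succ n ih =>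
      by_cases hn : n ∈ A
      · exact hmemA n hn
      -- Outside `A` nothing has to be packed, so the previous inequality persists.
      · rw [Finset.sum_range_succ, Finset.sum_range_succ]
        have : b' n = 0 := by simp [hb', hn]
        linarith [ha'0 n]
  obtain ⟨m, hm, hfib⟩ := exists_bin_packing ha'0 hb'0
    (fun j k hjk hj => by
      have h4 : 4 * b j ≤ a j := by
        by_contra h
        simp [ha', h] at hj
      have : a' j = a j := by simp [ha', h4]
      rw [this]
      linarith [hb'le k, hanti hjk.le])
    (fun k hk => by
      have h4 : ¬ (4 * b k ≤ a k) := by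
        intro h
        simp only [hb', h, not_true, and_false, if_false, lt_irrefl] at hk
      simp [ha', h4]) hsum
  set m' : ℕ → ℕ := fun k => if 4 * b k ≤ a k ∨ b k = 0 then k else m k with hm'
  have hpos : ∀ k ∈ A, ¬ (4 * b k ≤ a k ∨ b k = 0) → 0 < b' k ∧ b' k = 4 * b k := by
    intro k hk h
    push Not at h
    have : b' k = 4 * b k := by simp [hb', hk, h.1]
    exact ⟨by rw [this]; have := lt_of_le_of_ne (hb k) h.2.symm; linarith, this⟩
  have ha'le : ∀ k, a' k ≤ a k := fun k => by
    simp only [ha']; split_ifs; exacts [le_rfl, ha k]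
  refine ⟨m', fun k hk => ?_, fun j F hF => ?_⟩
  · by_cases h : 4 * b k ≤ a k ∨ b k = 0
    · simp only [hm', if_pos h]
      rcases h with h | h
      · linarith [hb k]
      · rw [h]; exact ha k
    · simp only [hm', if_neg h]
      obtain ⟨h1, h2⟩ := hpos k hk h
      have := hfib (m k) {k} (by simpa using h1)
      rw [Finset.sum_singleton, h2] at this
      linarith [ha'le (m k), ha (m k)]
  · rw [← Finset.sum_filter_add_sum_filter_not F (fun k => 4 * b k ≤ a k ∨ b k = 0)]
    have h1 : ∑ k ∈ F with (4 * b k ≤ a k ∨ b k = 0), b k ≤ a j / 4 := by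
      have : ∀ k ∈ F.filter (fun k => 4 * b k ≤ a k ∨ b k = 0), b k ≤
          if k = j then a j / 4 else 0 := by
        intro k hk
        obtain ⟨hkF, h⟩ := Finset.mem_filter.1 hk
        have hj := (hF k hkF).2
        simp only [hm', if_pos h] at hj
        subst hj
        rw [if_pos rfl]
        rcases h with h | h
        · linarith
        · rw [h]; linarith [ha k]
      refine (Finset.sum_le_sum this).trans ?_
      rw [Finset.sum_ite_eq' _ j]
      split_ifs
      · exact le_rfl
      · linarith [ha j]
    have h2 : ∑ k ∈ F with ¬ (4 * b k ≤ a k ∨ b k = 0), 4 * b k ≤ 2 * a' j := by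
      refine le_trans (Finset.sum_congr rfl fun k hk => ?_).le
        (hfib j (F.filter fun k => ¬ (4 * b k ≤ a k ∨ b k = 0)) fun k hk => ?_)
      · obtain ⟨hkF, h⟩ := Finset.mem_filter.1 hk
        exact ((hpos k (hF k hkF).1 h).2).symm
      · obtain ⟨hkF, h⟩ := Finset.mem_filter.1 hk
        refine ⟨(hpos k (hF k hkF).1 h).1, ?_⟩
        have hj := (hF k hkF).2
        simpa only [hm', if_neg h] using hj
    rw [← Finset.mul_sum] at h2
    linarith [ha'le j, ha j]

/-- If the tails of `b` are bounded by those of `a`, there are disjoint finite groups of indices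
such that the `a`-mass of the `k`-th group is at least a quarter of `b k`. -/
theorem exists_disjoint_groups {a b : ℕ → ℝ} (ha : ∀ k, 0 ≤ a k) (hb : ∀ k, 0 ≤ b k)
    (has : Summable a) (hbs : Summable b)
    (hba : ∀ j k, k ≤ j → 0 < b k → a j ≤ b k / 2)
    (hsum : ∀ n, ∑' k, b (k + n) ≤ ∑' k, a (k + n)) :
    ∃ G : ℕ → Finset ℕ, (∀ k l, k ≠ l → Disjoint (G k) (G l)) ∧
      ∀ k, b k ≤ 4 * ∑ j ∈ G k, a j := by
  set W : ℕ → ℝ := fun n => ∑' k, b (k + n) with hW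
  set M : ℕ → ℝ := fun n => ∑' k, a (k + n) with hM
  have hWs : ∀ n, W n = b n + W (n + 1) := by
    intro n
    have := ((summable_nat_add_iff n).2 hbs).tsum_eq_zero_add
    simp only [hW]
    rw [this, zero_add]
    congr 1
    exact tsum_congr fun k => by congr 1; ring
  have hMs : ∀ n, M n = a n + M (n + 1) := by
    intro n
    have := ((summable_nat_add_iff n).2 has).tsum_eq_zero_add
    simp only [hM]
    rw [this, zero_add]
    congr 1
    exact tsum_congr fun k => by congr 1; ring
  have hW0 : ∀ n, 0 ≤ W n := fun n => tsum_nonneg fun k => hb _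
  have hWa : Antitone W := antitone_nat_of_succ_le fun n => by rw [hWs n]; linarith [hb n]
  have hMa : Antitone M := antitone_nat_of_succ_le fun n => by rw [hMs n]; linarith [ha n]
  have hMt : Filter.Tendsto M Filter.atTop (nhds 0) := tendsto_sum_nat_add a
  have hex : ∀ c : ℝ, 0 < c → ∃ j, M j ≤ c := fun c hc =>
    ((hMt.eventually (gt_mem_nhds hc)).exists).imp fun _ h => h.le
  -- The group of `k` consists of the `j` whose tail mass `M j` lies in `(W (k + 1) + b k / 4, W
  -- k]`; these intervals are disjoint. The margin `b k / 4` keeps the lower threshold positive even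
  -- if `W (k + 1) = 0`, so the group is finite.
  have hG : ∀ k, ∃ G : Finset ℕ, b k ≤ 4 * ∑ j ∈ G, a j ∧ ∀ j ∈ G, W (k + 1) < M j ∧ M j ≤ W k := by
    intro k
    rcases (hb k).eq_or_lt with h0 | hk
    · exact ⟨∅, by simp [← h0], by simp⟩
    have hWk : 0 < W k := by rw [hWs]; linarith [hW0 (k + 1)]
    have hWk' : 0 < W (k + 1) + b k / 4 := by linarith [hW0 (k + 1)]
    classical
    set j₀ := Nat.find (hex _ hWk) with hj₀
    set j₁ := Nat.find (hex _ hWk') with hj₁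
    have h0 : M j₀ ≤ W k := Nat.find_spec (hex _ hWk)
    have h1 : M j₁ ≤ W (k + 1) + b k / 4 := Nat.find_spec (hex _ hWk')
    have h01 : j₀ ≤ j₁ := Nat.find_min' _ (by rw [hWs]; linarith)
    -- The first `M j` below `W k` undershoots it by at most one term of `a`, of size at most `b k /
    -- 2`. Subtracting this and the margin from `b k` leaves a quarter.
    have h2 : W k - b k / 2 ≤ M j₀ := by
      rcases le_or_gt j₀ k with hle | hlt
      · have := hMa hle
        have := hsum k
        change W k ≤ M k at this
        linarith
      · obtain ⟨i, hi⟩ : ∃ i, j₀ = i + 1 := ⟨j₀ - 1, by omega⟩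
        have h3 : ¬ M i ≤ W k := Nat.find_min (hex _ hWk) (by rw [← hj₀]; omega)
        have h4 := hMs i
        have h5 := hba i k (by omega) hk
        rw [hi]
        linarith
    refine ⟨Finset.Ico j₀ j₁, ?_, fun j hj => ?_⟩
    · have hI : ∀ d, ∑ j ∈ Finset.Ico j₀ (j₀ + d), a j = M j₀ - M (j₀ + d) := by
        intro d
        induction d with
        | zero => simp
        | succ d ih =>
          rw [← add_assoc, Finset.sum_Ico_succ_top (by omega), ih, hMs (j₀ + d)]
          ring
      have := hI (j₁ - j₀)
      rw [Nat.add_sub_cancel' h01] at this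
      rw [this]
      have := hWs k
      linarith
    · obtain ⟨hj0, hj1⟩ := Finset.mem_Ico.1 hj
      have h3 : ¬ M j ≤ W (k + 1) + b k / 4 := Nat.find_min (hex _ hWk') hj1
      exact ⟨by linarith, (hMa hj0).trans h0⟩
  choose G hG1 hG2 using hG
  refine ⟨G, fun k l hkl => ?_, hG1⟩
  have key : ∀ k l, k < l → Disjoint (G k) (G l) := by
    intro k l hkl
    rw [Finset.disjoint_left]
    intro j hjk hjl
    have := hWa (show k + 1 ≤ l by omega)
    linarith [(hG2 k j hjk).1, (hG2 l j hjl).2]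
  rcases lt_or_gt_of_ne hkl with h | h
  · exact key k l h
  · exact (key l k h).symm

/-- Only the `k ∈ B` with `a k < b k` need a group; they are enlarged to `4 * b k` to absorb the
quarter in `exists_disjoint_groups`. Keeping only the `a k` with `b k ≤ a k` loses at most `∑ b`, so
`5 = 4 + 1` suffices. -/
theorem exists_tail_grouping {a b : ℕ → ℝ} (ha : ∀ k, 0 ≤ a k) (hb : ∀ k, 0 ≤ b k)
    (has : Summable a) (hbs : Summable b) (hanti : Antitone a) (B : Set ℕ)
    (hB : ∀ n ∈ B, 5 * ∑' k, b (k + n) ≤ ∑' k, a (k + n)) :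
    ∃ G : ℕ → Finset ℕ, (∀ k l, k ≠ l → Disjoint (G k) (G l)) ∧
      ∀ k ∈ B, a k < b k → b k ≤ ∑ j ∈ G k, a j := by
  classical
  set a' : ℕ → ℝ := fun k => if b k ≤ a k then a k else 0 with ha'
  set b' : ℕ → ℝ := fun k => if k ∈ B ∧ a k < b k then 4 * b k else 0 with hb'
  have ha'0 : ∀ k, 0 ≤ a' k := fun k => by simp only [ha']; split_ifs; exacts [ha k, le_rfl]
  have ha'le : ∀ k, a' k ≤ a k := fun k => by
    simp only [ha']; split_ifs; exacts [le_rfl, ha k]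
  have hb'0 : ∀ k, 0 ≤ b' k := fun k => by
    simp only [hb']; split_ifs; exacts [by linarith [hb k], le_rfl]
  have hb'le : ∀ k, b' k ≤ 4 * b k := fun k => by
    simp only [hb']; split_ifs; exacts [le_rfl, by linarith [hb k]]
  have ha's : Summable a' := has.of_nonneg_of_le ha'0 ha'le
  have hb's : Summable b' := (hbs.mul_left 4).of_nonneg_of_le hb'0 hb'le
  have sh : ∀ {f : ℕ → ℝ}, Summable f → ∀ n, Summable fun k => f (k + n) :=
    fun h n => (summable_nat_add_iff n).2 h
  have hmem : ∀ n ∈ B, ∑' k, b' (k + n) ≤ ∑' k, a' (k + n) := by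
    intro n hn
    have h1 : ∑' k, b' (k + n) ≤ 4 * ∑' k, b (k + n) := by
      rw [← tsum_mul_left]
      exact (sh hb's n).tsum_le_tsum (fun k => hb'le _) ((sh hbs n).mul_left 4)
    have h2 : ∑' k, a (k + n) ≤ ∑' k, a' (k + n) + ∑' k, b (k + n) := by
      rw [← (sh ha's n).tsum_add (sh hbs n)]
      refine (sh has n).tsum_le_tsum (fun k => ?_) ((sh ha's n).add (sh hbs n))
      simp only [ha']
      split_ifs with h <;> linarith [hb (k + n)]
    linarith [hB n hn]
  have hsum : ∀ n, ∑' k, b' (k + n) ≤ ∑' k, a' (k + n) := by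
    intro n
    -- Advance to the first index of `B` from `n` on: the terms of `b'` skipped are zero.
    by_cases hex : ∃ d, d + n ∈ B
    · have hd := Nat.find_spec hex
      set d := Nat.find hex
      have h1 : ∀ i ∈ Finset.range d, b' (i + n) = 0 := by
        intro i hi
        have := Nat.find_min hex (Finset.mem_range.1 hi)
        simp [hb', this]
      rw [← (sh hb's n).sum_add_tsum_nat_add d, ← (sh ha's n).sum_add_tsum_nat_add d,
        Finset.sum_eq_zero h1, zero_add]
      simp_rw [add_assoc]
      exact (hmem _ hd).trans (le_add_of_nonneg_left (Finset.sum_nonneg fun i _ => ha'0 _))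
    · push Not at hex
      have : ∀ k, b' (k + n) = 0 := fun k => by simp [hb', hex k]
      simp_rw [this, tsum_zero]
      exact tsum_nonneg fun k => ha'0 _
  obtain ⟨G, hG, hG'⟩ := exists_disjoint_groups ha'0 hb'0 ha's hb's (fun j k hkj hk => by
    have h : k ∈ B ∧ a k < b k := by
      by_contra h
      simp only [hb', if_neg h, lt_irrefl] at hk
    have : b' k = 4 * b k := by simp only [hb', if_pos h]
    rw [this]
    linarith [ha'le j, hanti hkj, hb k, h.2]) hsum
  refine ⟨G, hG, fun k hk hlt => ?_⟩
  have h1 := hG' k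
  have : b' k = 4 * b k := by simp only [hb', if_pos (And.intro hk hlt)]
  rw [this] at h1
  have h2 : ∑ j ∈ G k, a' j ≤ ∑ j ∈ G k, a j := Finset.sum_le_sum fun j _ => ha'le j
  linarith

/-- Either the heads of `g` up to `n` are controlled by `H`, or its tails by `R`. -/
theorem head_or_tail_le {p q C H R : ℝ} (hp : 0 < p) (hpq : p < q) {n : ℕ}
    (hH : n = 0 → H = 0) {g a b : ℕ → ℝ} (hg : ∀ k, 0 ≤ g k)
    (ha : ∀ k, 0 ≤ a k) (hb : ∀ k, 0 ≤ b k) (hanti : Antitone g) (hgab : ∀ k, g k ≤ a k + b k)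
    (haH : ∀ F : Finset ℕ, ∑ k ∈ F, a k ^ p ≤ C * H)
    (hbR : ∀ F : Finset ℕ, ∑ k ∈ F, b k ^ q ≤ C * R) :
    (0 < n ∧ ∑ k ∈ Finset.range n, g k ^ p ≤ 2 * 2 ^ p * C * H) ∨
      ∀ F : Finset ℕ, (∀ k ∈ F, n ≤ k) → ∑ k ∈ F, g k ^ q ≤ 2 * 2 ^ q * C * R := by
  have hq : 0 < q := hp.trans hpq
  have h2p : (0 : ℝ) < 2 ^ p := by positivity
  have h2q : (0 : ℝ) < 2 ^ q := by positivity
  have hA : ∀ F : Finset ℕ, ∑ k ∈ F with ¬ (a k < b k), g k ^ p ≤ 2 ^ p * C * H := by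
    intro F
    rw [mul_assoc]
    refine le_trans ?_ (mul_le_mul_of_nonneg_left (haH (F.filter fun k => ¬ (a k < b k))) h2p.le)
    rw [Finset.mul_sum]
    refine Finset.sum_le_sum fun k hk => ?_
    rw [← Real.mul_rpow (by norm_num) (ha k)]
    exact Real.rpow_le_rpow (hg k) (by linarith [hgab k, (Finset.mem_filter.1 hk).2]) hp.le
  have hB : ∀ F : Finset ℕ, ∑ k ∈ F with a k < b k, g k ^ q ≤ 2 ^ q * C * R := by
    intro F
    rw [mul_assoc]
    refine le_trans ?_ (mul_le_mul_of_nonneg_left (hbR (F.filter fun k => a k < b k)) h2q.le)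
    rw [Finset.mul_sum]
    refine Finset.sum_le_sum fun k hk => ?_
    rw [← Real.mul_rpow (by norm_num) (hb k)]
    exact Real.rpow_le_rpow (hg k) (by linarith [hgab k, (Finset.mem_filter.1 hk).2]) hq.le
  by_cases hhead : 0 < n ∧ ∑ k ∈ Finset.range n, g k ^ p ≤ 2 * 2 ^ p * C * H
  · exact Or.inl hhead
  refine Or.inr fun F hF => ?_
  have hgn : 0 ≤ g n ^ (q - p) := Real.rpow_nonneg (hg n) _
  have hsplit : ∀ k, g k ^ q = g k ^ p * g k ^ (q - p) := fun k => by
    rw [← Real.rpow_add_of_nonneg (hg k) hp.le (by linarith)]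
    congr 1; ring
  -- If the head is too large, less than half of it comes from indices with `b ≤ a`, so the indices
  -- with `a < b` carry at least `2 ^ p * C * H`. There `g k ≥ g n` converts `p`-th powers into
  -- `q`-th powers bounded by `R`. For `n = 0` the claim is trivial because `H = 0`.
  have hkey : g n ^ (q - p) * (2 ^ p * C * H) ≤ 2 ^ q * C * R := by
    have h1 := Finset.sum_filter_add_sum_filter_not (Finset.range n) (fun k => a k < b k)
      (fun k => g k ^ p)
    have h2 := hA (Finset.range n)
    have h3 : 2 ^ p * C * H ≤ ∑ k ∈ Finset.range n with a k < b k, g k ^ p := by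
      rcases Nat.eq_zero_or_pos n with h0 | h0
      · rw [hH h0, h0]; simp
      · have := not_le.1 fun h => hhead ⟨h0, h⟩
        linarith
    refine (mul_le_mul_of_nonneg_left h3 hgn).trans (le_trans ?_ (hB (Finset.range n)))
    rw [Finset.mul_sum]
    refine Finset.sum_le_sum fun k hk => ?_
    rw [hsplit k, mul_comm]
    have hkn := Finset.mem_range.1 (Finset.mem_filter.1 hk).1
    exact mul_le_mul_of_nonneg_left
      (Real.rpow_le_rpow (hg n) (hanti hkn.le) (by linarith)) (Real.rpow_nonneg (hg k) _)
  rw [← Finset.sum_filter_add_sum_filter_not F (fun k => a k < b k)]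
  -- In the tail `g k ≤ g n`, so the same exchange of exponents runs in the other direction, and
  -- `hkey` closes the loop.
  have h4 : ∑ k ∈ F with ¬ (a k < b k), g k ^ q ≤ g n ^ (q - p) * (2 ^ p * C * H) := by
    refine le_trans ?_ (mul_le_mul_of_nonneg_left (hA F) hgn)
    rw [Finset.mul_sum]
    refine Finset.sum_le_sum fun k hk => ?_
    rw [hsplit k, mul_comm]
    exact mul_le_mul_of_nonneg_right
      (Real.rpow_le_rpow (hg k) (hanti (hF k (Finset.mem_filter.1 hk).1)) (by linarith))
      (Real.rpow_nonneg (hg k) _)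
  linarith [hB F]

/-! ### Model operators: weighted compositions and groupings. -/

/-- The weighted composition operator `z ↦ (c k * z (m k))`. -/
def wcomp (c : ℕ → ℝ) (m : ℕ → ℕ) : (ℕ → ℝ) →ₗ[ℝ] (ℕ → ℝ) where
  toFun z k := c k * z (m k)
  map_add' x y := by ext k; simp [mul_add]
  map_smul' a x := by ext k; simp; ring

theorem wcomp_apply (c : ℕ → ℝ) (m : ℕ → ℕ) (z : ℕ → ℝ) (k : ℕ) :
    wcomp c m z k = c k * z (m k) := rfl

theorem enorm_le_one_iff_abs {a : ℝ} : ‖a‖ₑ ≤ 1 ↔ |a| ≤ 1 := by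
  rw [← ofReal_norm, Real.norm_eq_abs, ENNReal.ofReal_le_one]

/-- Weights of modulus at most 1 satisfy `|c| ^ t ≤ |c| ^ p`, so the fibre condition at `p` passes
to every larger exponent. -/
theorem pw_wcomp_le {p t : ℝ} (hp : 0 < p) (hpt : p ≤ t) {c : ℕ → ℝ} {m : ℕ → ℕ}
    (hc : ∀ k, |c k| ≤ 1)
    (hfib : ∀ (j : ℕ) (F : Finset ℕ), (∀ k ∈ F, m k = j) → ∑ k ∈ F, ‖c k‖ₑ ^ p ≤ 1)
    (z : ℕ → ℝ) : pw t (wcomp c m z) ≤ pw t z := by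
  have ht : 0 < t := hp.trans_le hpt
  unfold pw
  rw [← ENNReal.tsum_fiberwise _ m]
  refine ENNReal.tsum_le_tsum fun j => ?_
  have h1 : ∀ k : m ⁻¹' {j}, ‖wcomp c m z k‖ₑ ^ t ≤ ‖c k‖ₑ ^ p * ‖z j‖ₑ ^ t := by
    rintro ⟨k, hk⟩
    have hk' : m k = j := hk
    rw [wcomp_apply, enorm_mul, ENNReal.mul_rpow_of_nonneg _ _ ht.le, hk']
    gcongr ?_ * _
    exact ENNReal.rpow_le_rpow_of_exponent_ge (enorm_le_one_iff_abs.2 (hc k)) hpt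
  refine (ENNReal.tsum_le_tsum h1).trans ?_
  rw [ENNReal.tsum_mul_right]
  refine mul_le_of_le_one_left zero_le ?_
  rw [ENNReal.tsum_eq_iSup_sum, iSup_le_iff]
  intro F
  have := hfib j (F.map (Function.Embedding.subtype _)) (by
    intro k hk
    obtain ⟨⟨k', hk'⟩, -, rfl⟩ := Finset.mem_map.1 hk
    exact hk')
  rwa [Finset.sum_map] at this

theorem mapsBdd_wcomp {p : ℝ} (hp : 0 < p) {c : ℕ → ℝ} {m : ℕ → ℕ} (hc : ∀ k, |c k| ≤ 1)
    (hfib : ∀ (j : ℕ) (F : Finset ℕ), (∀ k ∈ F, m k = j) → ∑ k ∈ F, ‖c k‖ₑ ^ p ≤ 1)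
    {t : ℝ≥0∞} (ht : ENNReal.ofReal p ≤ t) : MapsBdd (wcomp c m) (ell t) 1 := by
  by_cases htop : t = ⊤
  · subst htop
    refine mapsBdd_top_of_forall fun z M hz k => ?_
    rw [wcomp_apply, abs_mul]
    exact mul_le_mul (hc k) (hz _) (abs_nonneg _) zero_le_one
  · have ht0 : 0 < t := (ENNReal.ofReal_pos.2 hp).trans_le ht
    have := mapsBdd_of_pw_le (T := wcomp c m) (c := 1) ht0 htop ENNReal.one_ne_top fun z _ => by
      rw [one_mul]
      exact pw_wcomp_le hp ((ENNReal.ofReal_le_iff_le_toReal htop).1 ht) hc hfib z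
    simpa using this

theorem mapsBdd_wcomp_of_injOn {c : ℕ → ℝ} {m : ℕ → ℕ} (hc : ∀ k, |c k| ≤ 1)
    (hm : Set.InjOn m {k | c k ≠ 0}) (t : ℝ≥0∞) : MapsBdd (wcomp c m) (ell t) 1 := by
  rcases eq_or_ne t 0 with rfl | ht
  · refine mapsBdd_zero_of_card fun z => ⟨m, fun k hk l hl h => hm ?_ ?_ h, fun k hk => ?_⟩
    · exact left_ne_zero_of_mul hk
    · exact left_ne_zero_of_mul hl
    · exact right_ne_zero_of_mul hk
  have hex : ∃ p : ℝ, 0 < p ∧ ENNReal.ofReal p ≤ t := by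
    rcases eq_or_ne t ⊤ with rfl | htop
    · exact ⟨1, one_pos, le_top⟩
    · exact ⟨t.toReal, ENNReal.toReal_pos ht htop, ENNReal.ofReal_toReal_le⟩
  obtain ⟨p, hp, hpt⟩ := hex
  refine mapsBdd_wcomp hp hc (fun j F hF => ?_) hpt
  have hone : ∀ k, ‖c k‖ₑ ^ p ≤ 1 := fun k =>
    ENNReal.rpow_le_one (enorm_le_one_iff_abs.2 (hc k)) hp.le
  by_cases h : ∃ k₀ ∈ F, c k₀ ≠ 0
  · obtain ⟨k₀, hk₀, hck₀⟩ := h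
    rw [Finset.sum_eq_single_of_mem k₀ hk₀]
    · exact hone k₀
    · intro k hk hne
      have : c k = 0 := by
        by_contra hck
        exact hne (hm hck hck₀ ((hF k hk).trans (hF k₀ hk₀).symm))
      simp [this, hp]
  · push Not at h
    rw [Finset.sum_eq_zero fun k hk => by simp [h k hk, hp]]
    exact zero_le_one

/-- The operator that replaces each group of coordinates by one linear combination. -/
def groupOp (c : ℕ → ℕ → ℝ) (G : ℕ → Finset ℕ) : (ℕ → ℝ) →ₗ[ℝ] (ℕ → ℝ) where
  toFun z k := ∑ j ∈ G k, c k j * z j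
  map_add' x y := by ext k; simp [mul_add, Finset.sum_add_distrib]
  map_smul' a x := by ext k; simp [Finset.mul_sum]; refine Finset.sum_congr rfl fun _ _ => by ring

theorem sum_rpow_le_rpow_sum {ι : Type*} {r : ℝ} (hr : 0 < r) (hr1 : r ≤ 1) (F : Finset ι)
    (f : ι → ℝ≥0∞) : (∑ i ∈ F, f i) ^ r ≤ ∑ i ∈ F, f i ^ r :=
  Finset.le_sum_of_subadditive (fun a : ℝ≥0∞ => a ^ r) (by simp [hr])
    (fun a b => ENNReal.rpow_add_le_add_rpow a b hr.le hr1) F f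

/-- Raising the `q`-estimate on a group to the power `t / q ≤ 1` is subadditive, so it passes to
every smaller exponent; disjoint groups are then summed. -/
theorem pw_groupOp_le {q t : ℝ} (ht : 0 < t) (htq : t ≤ q) {c : ℕ → ℕ → ℝ} {G : ℕ → Finset ℕ}
    (hG : ∀ k l, k ≠ l → Disjoint (G k) (G l))
    (hc : ∀ (k : ℕ) (z : ℕ → ℝ), |∑ j ∈ G k, c k j * z j| ^ q ≤ ∑ j ∈ G k, |z j| ^ q)
    (z : ℕ → ℝ) : pw t (groupOp c G z) ≤ pw t z := by
  have hq : 0 < q := ht.trans_le htq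
  rw [pw_le_iff_sum]
  intro F
  have h1 : ∀ k, ‖groupOp c G z k‖ₑ ^ t ≤ ∑ j ∈ G k, ‖z j‖ₑ ^ t := by
    intro k
    have h2 : ‖groupOp c G z k‖ₑ ^ q ≤ ∑ j ∈ G k, ‖z j‖ₑ ^ q := by
      simp_rw [enorm_rpow_eq_ofReal hq]
      rw [← ENNReal.ofReal_sum_of_nonneg fun _ _ => by positivity]
      exact ENNReal.ofReal_le_ofReal (hc k z)
    calc ‖groupOp c G z k‖ₑ ^ t = (‖groupOp c G z k‖ₑ ^ q) ^ (t / q) := by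
          rw [← ENNReal.rpow_mul, mul_div_cancel₀ _ hq.ne']
      _ ≤ (∑ j ∈ G k, ‖z j‖ₑ ^ q) ^ (t / q) := by gcongr
      _ ≤ ∑ j ∈ G k, (‖z j‖ₑ ^ q) ^ (t / q) :=
          sum_rpow_le_rpow_sum (by positivity) ((div_le_one hq).2 htq) _ _
      _ = _ := by
          refine Finset.sum_congr rfl fun j _ => ?_
          rw [← ENNReal.rpow_mul, mul_div_cancel₀ _ hq.ne']
  refine (Finset.sum_le_sum fun k _ => h1 k).trans ?_
  rw [← Finset.sum_biUnion fun k _ l _ h => hG k l h]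
  exact ENNReal.sum_le_tsum _

theorem mapsBdd_groupOp {q : ℝ} {c : ℕ → ℕ → ℝ} {G : ℕ → Finset ℕ}
    (hG : ∀ k l, k ≠ l → Disjoint (G k) (G l))
    (hc : ∀ (k : ℕ) (z : ℕ → ℝ), |∑ j ∈ G k, c k j * z j| ^ q ≤ ∑ j ∈ G k, |z j| ^ q)
    {t : ℝ≥0∞} (htq : t ≤ ENNReal.ofReal q) : MapsBdd (groupOp c G) (ell t) 1 := by
  rcases eq_or_ne t 0 with rfl | ht0
  · refine mapsBdd_zero_of_card fun z => ?_
    have hex : ∀ k, ∃ j, groupOp c G z k ≠ 0 → j ∈ G k ∧ z j ≠ 0 := by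
      intro k
      by_cases h : groupOp c G z k = 0
      · exact ⟨0, fun h' => absurd h h'⟩
      · obtain ⟨j, hj, hj'⟩ := Finset.exists_ne_zero_of_sum_ne_zero h
        exact ⟨j, fun _ => ⟨hj, right_ne_zero_of_mul hj'⟩⟩
    choose φ hφ using hex
    refine ⟨φ, fun k hk l hl h => ?_, fun k hk => (hφ k hk).2⟩
    by_contra hkl
    exact Finset.disjoint_left.1 (hG k l hkl) (hφ k hk).1 (h ▸ (hφ l hl).1)
  · have htop : t ≠ ⊤ := ne_top_of_le_ne_top ENNReal.ofReal_ne_top htq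
    have := mapsBdd_of_pw_le (T := groupOp c G) (c := 1) (pos_iff_ne_zero.2 ht0) htop
      ENNReal.one_ne_top fun z _ => by
        rw [one_mul]
        refine pw_groupOp_le (ENNReal.toReal_pos ht0 htop) ?_ hG hc z
        have hq : 0 < q := ENNReal.ofReal_pos.1 ((pos_iff_ne_zero.2 ht0).trans_le htq)
        exact (ENNReal.le_ofReal_iff_toReal_le htop hq.le).1 htq
    simpa using this

/-- A functional on a finite set of coordinates that takes the value `v` at `x` and is bounded
by the `ℓ^q` norm. -/
theorem exists_functional {q : ℝ} (hq : 1 ≤ q) (F : Finset ℕ) (x : ℕ → ℝ) (v : ℝ)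
    (hv : |v| ^ q ≤ ∑ j ∈ F, |x j| ^ q) :
    ∃ c : ℕ → ℝ, ∑ j ∈ F, c j * x j = v ∧
      ∀ z : ℕ → ℝ, |∑ j ∈ F, c j * z j| ^ q ≤ ∑ j ∈ F, |z j| ^ q := by
  have hq0 : 0 < q := by linarith
  set s := ∑ j ∈ F, |x j| ^ q with hs
  have hs0 : 0 ≤ s := Finset.sum_nonneg fun _ _ => by positivity
  rcases hs0.eq_or_lt with h0 | hpos
  · have hv0 : v = 0 := by
      have : |v| ^ q = 0 := le_antisymm (h0 ▸ hv) (by positivity)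
      rwa [Real.rpow_eq_zero (abs_nonneg _) hq0.ne', abs_eq_zero] at this
    refine ⟨0, by simp [hv0], fun z => ?_⟩
    simpa [hq0.ne'] using Finset.sum_nonneg fun j (_ : j ∈ F) => Real.rpow_nonneg (abs_nonneg (z j)) q
  -- The norming functional of `x` in `ℓ^q`, written with probability weights so that its bound is
  -- Jensen's inequality; this is where `1 ≤ q` enters.
  set w : ℕ → ℝ := fun j => |x j| ^ q / s with hw
  have hw0 : ∀ j, 0 ≤ w j := fun j => by positivity
  have hw1 : ∑ j ∈ F, w j = 1 := by rw [hw, ← Finset.sum_div, ← hs, div_self hpos.ne']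
  refine ⟨fun j => v * (w j / x j), ?_, fun z => ?_⟩
  · have : ∀ j ∈ F, v * (w j / x j) * x j = v * w j := by
      intro j _
      by_cases hx : x j = 0
      · simp [hw, hx, hq0.ne']
      · field_simp
    rw [Finset.sum_congr rfl this, ← Finset.mul_sum, hw1, mul_one]
  · have h1 : |∑ j ∈ F, v * (w j / x j) * z j| ≤ |v| * ∑ j ∈ F, w j * |z j / x j| := by
      rw [Finset.mul_sum]
      refine (Finset.abs_sum_le_sum_abs _ _).trans (Finset.sum_le_sum fun j _ => ?_)
      rw [show v * (w j / x j) * z j = v * (w j * (z j / x j)) by ring, abs_mul, abs_mul,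
        abs_of_nonneg (hw0 j)]
    have h2 := Real.rpow_arith_mean_le_arith_mean_rpow F w (fun j => |z j / x j|)
      (fun j _ => hw0 j) hw1 (fun j _ => abs_nonneg _) hq
    have h3 : ∀ j ∈ F, s * (w j * |z j / x j| ^ q) ≤ |z j| ^ q := by
      intro j _
      by_cases hx : x j = 0
      · simp only [hw, hx, abs_zero, Real.zero_rpow hq0.ne', zero_div, zero_mul, mul_zero]
        positivity
      · have hxq : 0 < |x j| ^ q := Real.rpow_pos_of_pos (abs_pos.2 hx) _
        rw [abs_div, Real.div_rpow (abs_nonneg _) (abs_nonneg _)]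
        apply le_of_eq
        simp only [hw]
        field_simp
    calc |∑ j ∈ F, v * (w j / x j) * z j| ^ q
        ≤ (|v| * ∑ j ∈ F, w j * |z j / x j|) ^ q := by gcongr
      _ = |v| ^ q * (∑ j ∈ F, w j * |z j / x j|) ^ q :=
          Real.mul_rpow (abs_nonneg _) (Finset.sum_nonneg fun j _ => mul_nonneg (hw0 j) (abs_nonneg _))
      _ ≤ s * ∑ j ∈ F, w j * |z j / x j| ^ q :=
          mul_le_mul hv h2 (Real.rpow_nonneg (Finset.sum_nonneg fun j _ =>
            mul_nonneg (hw0 j) (abs_nonneg _)) _) hs0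
      _ ≤ _ := by rw [Finset.mul_sum]; exact Finset.sum_le_sum h3

/-- The packing of `|g k| ^ p` into `|f j| ^ p` gives the coefficients `g k / f (m k)`, and dividing
a bin by its capacity is the fibre condition. Where `f (m k) = 0`, also `g k = 0`. -/
theorem exists_head_operator {p : ℝ} (hp : 0 < p) {f g : ℕ → ℝ} (hg : Antitone fun k => |g k|)
    (A : Set ℕ)
    (hA : ∀ n ∈ A, 8 * ∑ k ∈ Finset.range (n + 1), |g k| ^ p ≤
      ∑ k ∈ Finset.range (n + 1), |f k| ^ p) :
    ∃ S : (ℕ → ℝ) →ₗ[ℝ] (ℕ → ℝ), (∀ t, ENNReal.ofReal p ≤ t → MapsBdd S (ell t) 1) ∧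
      S f = A.indicator g := by
  classical
  obtain ⟨m, hm, hfib⟩ := exists_head_packing (a := fun k => |f k| ^ p) (b := fun k => |g k| ^ p)
    (fun _ => by positivity) (fun _ => by positivity)
    (fun i j h => Real.rpow_le_rpow (abs_nonneg _) (hg h) hp.le) A hA
  have hle : ∀ k ∈ A, |g k| ≤ |f (m k)| := fun k hk =>
    (Real.rpow_le_rpow_iff (abs_nonneg _) (abs_nonneg _) hp).1 (hm k hk)
  refine ⟨wcomp (A.indicator fun k => g k / f (m k)) m, fun t ht => mapsBdd_wcomp hp ?_ ?_ ht, ?_⟩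
  · intro k
    by_cases hk : k ∈ A
    · rw [Set.indicator_of_mem hk, abs_div]
      exact div_le_one_of_le₀ (hle k hk) (abs_nonneg _)
    · simp [Set.indicator_of_notMem hk]
  · intro j F hF
    simp_rw [enorm_rpow_eq_ofReal hp]
    rw [← ENNReal.ofReal_sum_of_nonneg fun _ _ => by positivity, ENNReal.ofReal_le_one]
    have h1 : ∑ k ∈ F, |A.indicator (fun k => g k / f (m k)) k| ^ p =
        (∑ k ∈ F with k ∈ A, |g k| ^ p) / |f j| ^ p := by
      rw [Finset.sum_div, Finset.sum_filter]
      refine Finset.sum_congr rfl fun k hk => ?_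
      by_cases hkA : k ∈ A
      · rw [if_pos hkA, Set.indicator_of_mem hkA, abs_div,
          Real.div_rpow (abs_nonneg _) (abs_nonneg _), hF k hk]
      · rw [if_neg hkA, Set.indicator_of_notMem hkA, abs_zero, Real.zero_rpow hp.ne']
    rw [h1]
    refine div_le_one_of_le₀ (hfib j _ fun k hk => ?_) (by positivity)
    exact ⟨(Finset.mem_filter.1 hk).2, hF k (Finset.mem_filter.1 hk).1⟩
  · ext k
    rw [wcomp_apply]
    by_cases hk : k ∈ A
    · rw [Set.indicator_of_mem hk, Set.indicator_of_mem hk]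
      by_cases h0 : f (m k) = 0
      · have := hle k hk
        rw [h0, abs_zero, abs_nonpos_iff] at this
        simp [h0, this]
      · field_simp
    · simp [Set.indicator_of_notMem hk]

/-- `D` is a diagonal multiplier producing the entries with `|g k| ≤ |f k|`. `S` produces the larger
ones, each by a functional on its own group of coordinates of `f`. -/
theorem exists_tail_operator {q : ℝ} (hq : 1 ≤ q) {f g : ℕ → ℝ} (hf : Antitone fun k => |f k|)
    (hfs : Summable fun k => |f k| ^ q) (hgs : Summable fun k => |g k| ^ q) (B : Set ℕ)
    (hB : ∀ n ∈ B, 5 * ∑' k, |g (k + n)| ^ q ≤ ∑' k, |f (k + n)| ^ q) :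
    ∃ D S : (ℕ → ℝ) →ₗ[ℝ] (ℕ → ℝ), (∀ t, MapsBdd D (ell t) 1) ∧
      (∀ t, t ≤ ENNReal.ofReal q → MapsBdd S (ell t) 1) ∧ D f + S f = B.indicator g := by
  classical
  have hq0 : 0 < q := by linarith
  obtain ⟨G, hG, hG'⟩ := exists_tail_grouping (a := fun k => |f k| ^ q) (b := fun k => |g k| ^ q)
    (fun _ => by positivity) (fun _ => by positivity) hfs hgs
    (fun i j h => Real.rpow_le_rpow (abs_nonneg _) (hf h) hq0.le) B hB
  set v : ℕ → ℝ := fun k => if k ∈ B ∧ |f k| < |g k| then g k else 0 with hv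
  have hvG : ∀ k, |v k| ^ q ≤ ∑ j ∈ G k, |f j| ^ q := by
    intro k
    simp only [hv]
    split_ifs with h
    · exact hG' k h.1 (Real.rpow_lt_rpow (abs_nonneg _) h.2 hq0)
    · rw [abs_zero, Real.zero_rpow hq0.ne']
      exact Finset.sum_nonneg fun _ _ => by positivity
  choose c hc hc' using fun k => exists_functional hq (G k) f (v k) (hvG k)
  refine ⟨wcomp (fun k => if k ∈ B ∧ |g k| ≤ |f k| then g k / f k else 0) id, groupOp c G,
    fun t => mapsBdd_wcomp_of_injOn (fun k => ?_) (Set.injOn_id _) t,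
    fun t ht => mapsBdd_groupOp hG hc' ht, ?_⟩
  · split_ifs with h
    · rw [abs_div]
      exact div_le_one_of_le₀ h.2 (abs_nonneg _)
    · simp
  · ext k
    rw [Pi.add_apply, wcomp_apply, show groupOp c G f k = v k from hc k]
    by_cases hk : k ∈ B
    · rw [Set.indicator_of_mem hk]
      rcases le_or_gt |g k| |f k| with h | h
      · simp only [hv, hk, h, not_lt.2 h, and_self, and_false, if_true, if_false, add_zero, id]
        by_cases h0 : f k = 0
        · rw [h0, abs_zero, abs_nonpos_iff] at h
          simp [h0, h]
        · field_simp
      · simp [hv, hk, h, not_le.2 h]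
    · simp [hv, hk]

/-! ### Decomposition into contractions from the splittings of `y`. -/

theorem tendsto_zero_of_pw {t : ℝ} (ht : 0 < t) {z : ℕ → ℝ} (h : pw t z ≠ ⊤) :
    Filter.Tendsto z Filter.atTop (nhds 0) := by
  have h1 := ((pw_ne_top_iff_summable ht).1 h).tendsto_atTop_zero
  have h2 := h1.rpow_const (p := 1 / t) (Or.inr (by positivity))
  rw [Real.zero_rpow (by positivity)] at h2
  rw [tendsto_zero_iff_abs_tendsto_zero]
  refine h2.congr fun k => ?_
  rw [← Real.rpow_mul (abs_nonneg _), mul_one_div_cancel ht.ne', Real.rpow_one]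
  rfl

theorem sum_comp_le_of_pw_le {t : ℝ} (ht : 0 < t) {z : ℕ → ℝ} {M : ℝ} (hM : 0 ≤ M)
    (h : pw t z ≤ ENNReal.ofReal M) {τ : ℕ → ℕ} (hτ : Function.Injective τ) (F : Finset ℕ) :
    ∑ k ∈ F, |z (τ k)| ^ t ≤ M := by
  rw [← ENNReal.ofReal_le_ofReal_iff hM, ENNReal.ofReal_sum_of_nonneg fun _ _ => by positivity]
  simp_rw [← enorm_rpow_eq_ofReal ht]
  have := pw_le_iff_sum.1 h (F.map ⟨τ, hτ⟩)
  rwa [Finset.sum_map] at this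

theorem pw_indicator_image {t : ℝ} (ht : 0 < t) {x : ℕ → ℝ} {σ : ℕ → ℕ}
    (hσ : Function.Injective σ) (n : ℕ) :
    pw t (((Finset.range n).map ⟨σ, hσ⟩ : Set ℕ).indicator x) =
      ENNReal.ofReal (∑ k ∈ Finset.range n, |x (σ k)| ^ t) := by
  unfold pw
  rw [tsum_eq_sum (s := (Finset.range n).map ⟨σ, hσ⟩), Finset.sum_map,
    ENNReal.ofReal_sum_of_nonneg fun _ _ => by positivity]
  · refine Finset.sum_congr rfl fun k hk => ?_
    rw [Set.indicator_of_mem, enorm_rpow_eq_ofReal ht]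
    · rfl
    · exact Finset.mem_coe.2 (Finset.mem_map_of_mem _ hk)
  · intro k hk
    rw [Set.indicator_of_notMem (by simpa using hk)]
    simp [ht]

theorem pw_indicator_image_compl {t : ℝ} (ht : 0 < t) {x : ℕ → ℝ} (hx : pw t x ≠ ⊤) {σ : ℕ → ℕ}
    (hσ : Function.Injective σ) (hsupp : ∀ k, x k ≠ 0 → k ∈ Set.range σ) (n : ℕ) :
    pw t (((Finset.range n).map ⟨σ, hσ⟩ : Set ℕ)ᶜ.indicator x) =
      ENNReal.ofReal (∑' k, |x (σ (k + n))| ^ t) := by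
  have hs : Summable fun k => |x (σ (k + n))| ^ t :=
    ((pw_ne_top_iff_summable ht).1 hx).comp_injective (hσ.comp (add_left_injective n))
  rw [ENNReal.ofReal_tsum_of_nonneg (fun _ => by positivity) hs]
  unfold pw
  have hinj : Function.Injective fun k => σ (k + n) := hσ.comp (add_left_injective n)
  have hnot : ∀ k, σ (k + n) ∉ ((Finset.range n).map ⟨σ, hσ⟩ : Set ℕ) := by
    intro k hk
    obtain ⟨i, hi, hik⟩ := Finset.mem_map.1 (Finset.mem_coe.1 hk)
    have := hσ hik
    have := Finset.mem_range.1 hi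
    omega
  rw [← hinj.tsum_eq]
  · refine tsum_congr fun k => ?_
    rw [Set.indicator_of_mem (Set.mem_compl (hnot k)), enorm_rpow_eq_ofReal ht]
  · intro k hk
    have hk' : ((Finset.range n).map ⟨σ, hσ⟩ : Set ℕ)ᶜ.indicator x k ≠ 0 := by
      intro h0
      refine hk ?_
      simp only [h0]
      simp [ht]
    have hmem := Set.mem_of_indicator_ne_zero hk'
    rw [Set.indicator_of_mem hmem] at hk'
    obtain ⟨i, rfl⟩ := hsupp k hk'
    have hi : n ≤ i := by
      by_contra! hlt
      exact hmem (Finset.mem_coe.2 (Finset.mem_map_of_mem ⟨σ, hσ⟩ (Finset.mem_range.2 hlt)))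
    exact ⟨i - n, by simp [Nat.sub_add_cancel hi]⟩

theorem exists_unrearrange {y : ℕ → ℝ} {τ : ℕ → ℕ} (hτ : Function.Injective τ)
    (hsupp : ∀ k, y k ≠ 0 → k ∈ Set.range τ) :
    ∃ V : (ℕ → ℝ) →ₗ[ℝ] (ℕ → ℝ), (∀ t, MapsBdd V (ell t) 1) ∧ V (fun k => y (τ k)) = y := by
  classical
  refine ⟨wcomp ((Set.range τ).indicator 1) (Function.invFun τ),
    fun t => mapsBdd_wcomp_of_injOn (fun k => ?_) ?_ t, ?_⟩
  · by_cases hk : k ∈ Set.range τ <;> simp [hk]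
  · intro k hk l hl h
    obtain ⟨i, rfl⟩ := Set.mem_of_indicator_ne_zero hk
    obtain ⟨j, rfl⟩ := Set.mem_of_indicator_ne_zero hl
    rw [Function.leftInverse_invFun hτ, Function.leftInverse_invFun hτ] at h
    rw [h]
  · ext k
    rw [wcomp_apply]
    by_cases hk : k ∈ Set.range τ
    · obtain ⟨i, rfl⟩ := hk
      rw [Function.leftInverse_invFun hτ]
      simp
    · rw [Set.indicator_of_notMem hk, zero_mul]
      by_contra h
      exact hk (hsupp k (Ne.symm h))

theorem mapsBdd_rearrange {σ : ℕ → ℕ} (hσ : Function.Injective σ) (t : ℝ≥0∞) :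
    MapsBdd (wcomp 1 σ) (ell t) 1 :=
  mapsBdd_wcomp_of_injOn (by simp) hσ.injOn t

theorem le_rpow_of_rpow_inv_le {p K l : ℝ} (hp : 0 < p) (hK : 0 ≤ K) (h : K ^ (1 / p) ≤ l) :
    K ≤ l ^ p := by
  have := Real.rpow_le_rpow (by positivity) h hp.le
  rwa [← Real.rpow_mul hK, one_div_mul_cancel hp.ne', Real.rpow_one] at this

theorem head_succ_le {p M : ℝ} (hp : 0 < p) {g : ℕ → ℝ} (hg : Antitone fun k => |g k|) {n : ℕ}
    (hn : 0 < n) (h : ∑ k ∈ Finset.range n, |g k| ^ p ≤ M) :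
    ∑ k ∈ Finset.range (n + 1), |g k| ^ p ≤ 2 * M := by
  rw [Finset.sum_range_succ]
  have h1 : |g n| ^ p ≤ |g 0| ^ p := Real.rpow_le_rpow (abs_nonneg _) (hg (Nat.zero_le n)) hp.le
  have h2 : |g 0| ^ p ≤ ∑ k ∈ Finset.range n, |g k| ^ p :=
    Finset.single_le_sum (f := fun k => |g k| ^ p) (fun _ _ => by positivity)
      (Finset.mem_range.2 hn)
  linarith

/-- If `y` splits along every finite set of coordinates of `x` as the image under an operator
bounded on `ℓ^p` and `ℓ^q` would, then `y` is obtained from `x` by contractions of `ℓ^t` for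
`t ≥ p`, and of `ℓ^t` for `t ≤ q`. -/
theorem exists_contractions {p q : ℝ} (hp : 0 < p) (hpq : p < q) (hq : 1 ≤ q) {C : ℝ}
    (hC : 0 ≤ C) :
    ∃ K : ℝ, ∀ x y : ℕ → ℝ, pw q x ≠ ⊤ → pw q y ≠ ⊤ →
      (∀ F : Finset ℕ, ∃ a b : ℕ → ℝ, y = a + b ∧
        pw p a ≤ ENNReal.ofReal C * pw p ((F : Set ℕ).indicator x) ∧
        pw q b ≤ ENNReal.ofReal C * pw q ((F : Set ℕ)ᶜ.indicator x)) →
      ∃ S₁ D S₂ : (ℕ → ℝ) →ₗ[ℝ] (ℕ → ℝ),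
        (∀ t, ENNReal.ofReal p ≤ t → MapsBdd S₁ (ell t) 1) ∧ (∀ t, MapsBdd D (ell t) 1) ∧
        (∀ t, t ≤ ENNReal.ofReal q → MapsBdd S₂ (ell t) 1) ∧ y = K • (S₁ x + (D x + S₂ x)) := by
  have hq0 : 0 < q := by linarith
  set K₁ : ℝ := 2 * 2 ^ p * C
  set K₂ : ℝ := 2 * 2 ^ q * C
  have hK₁ : 0 ≤ K₁ := by positivity
  have hK₂ : 0 ≤ K₂ := by positivity
  set l : ℝ := max 1 (max ((16 * K₁) ^ (1 / p)) ((5 * K₂) ^ (1 / q)))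
  have hl0 : 0 < l := one_pos.trans_le (le_max_left _ _)
  -- `y` is divided by `l` to meet the constants 8 and 5 of the head and tail operators; `16 = 8 *
  -- 2` because `head_succ_le` doubles when passing from `n` to `n + 1` terms.
  have hl₁ : 16 * K₁ ≤ l ^ p := le_rpow_of_rpow_inv_le hp (by positivity)
    ((le_max_left _ _).trans (le_max_right _ _))
  have hl₂ : 5 * K₂ ≤ l ^ q := le_rpow_of_rpow_inv_le hq0 (by positivity)
    ((le_max_right _ _).trans (le_max_right _ _))
  refine ⟨l, fun x y hx hy hsplit => ?_⟩
  obtain ⟨σ, hσ, hσa, hσs⟩ := exists_antitone_rearrangement (tendsto_zero_of_pw hq0 hx)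
  obtain ⟨τ, hτ, hτa, hτs⟩ := exists_antitone_rearrangement (tendsto_zero_of_pw hq0 hy)
  have hxs := ((pw_ne_top_iff_summable hq0).1 hx).comp_injective hσ
  have hys := ((pw_ne_top_iff_summable hq0).1 hy).comp_injective hτ
  change Summable fun k => |x (σ k)| ^ q at hxs
  change Summable fun k => |y (τ k)| ^ q at hys
  have hdich : ∀ n, (0 < n ∧ ∑ k ∈ Finset.range n, |y (τ k)| ^ p ≤
        K₁ * ∑ k ∈ Finset.range n, |x (σ k)| ^ p) ∨
      ∀ F : Finset ℕ, (∀ k ∈ F, n ≤ k) →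
        ∑ k ∈ F, |y (τ k)| ^ q ≤ K₂ * ∑' k, |x (σ (k + n))| ^ q := by
    intro n
    -- Cut `x` after its `n` largest entries.
    obtain ⟨a, b, hab, ha, hb⟩ := hsplit ((Finset.range n).map ⟨σ, hσ⟩)
    rw [pw_indicator_image hp hσ, ← ENNReal.ofReal_mul hC] at ha
    rw [pw_indicator_image_compl hq0 hx hσ hσs, ← ENNReal.ofReal_mul hC] at hb
    refine head_or_tail_le hp hpq (fun h0 => by simp [h0]) (fun k => abs_nonneg _)
      (fun k => abs_nonneg (a (τ k))) (fun k => abs_nonneg (b (τ k))) hτa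
      (fun k => by rw [hab]; exact abs_add_le _ _)
      (fun F => sum_comp_le_of_pw_le hp (mul_nonneg hC (Finset.sum_nonneg fun _ _ => by positivity))
        ha hτ F)
      (fun F => sum_comp_le_of_pw_le hq0 (mul_nonneg hC (tsum_nonneg fun _ => by positivity))
        hb hτ F)
  set g : ℕ → ℝ := fun k => l⁻¹ * y (τ k) with hg
  have hgabs : ∀ k, |g k| = l⁻¹ * |y (τ k)| := fun k => by
    rw [hg, abs_mul, abs_of_pos (inv_pos.2 hl0)]
  have hgpow : ∀ (r : ℝ) k, |g k| ^ r = (l ^ r)⁻¹ * |y (τ k)| ^ r := fun r k => by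
    rw [hgabs, Real.mul_rpow (inv_pos.2 hl0).le (abs_nonneg _), Real.inv_rpow hl0.le]
  have hga : Antitone fun k => |g k| := fun i j h => by
    simp only [hgabs]
    exact mul_le_mul_of_nonneg_left (hτa h) (inv_pos.2 hl0).le
  set B : Set ℕ := {n | ∀ F : Finset ℕ, (∀ k ∈ F, n ≤ k) →
    ∑ k ∈ F, |y (τ k)| ^ q ≤ K₂ * ∑' k, |x (σ (k + n))| ^ q} with hBdef
  obtain ⟨S₁, hS₁, hS₁x⟩ := exists_head_operator hp (f := fun k => x (σ k)) hga Bᶜ (by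
    intro n hn
    obtain ⟨hn0, hle⟩ := (hdich n).resolve_right hn
    have h1 := head_succ_le hp hτa hn0 hle
    simp_rw [hgpow p]
    rw [← Finset.mul_sum]
    have h2 : ∑ k ∈ Finset.range n, |x (σ k)| ^ p ≤ ∑ k ∈ Finset.range (n + 1), |x (σ k)| ^ p := by
      rw [Finset.sum_range_succ]
      exact le_add_of_nonneg_right (by positivity)
    have hlp : 0 < l ^ p := by positivity
    have h3 : 0 ≤ ∑ k ∈ Finset.range (n + 1), |x (σ k)| ^ p :=
      Finset.sum_nonneg fun _ _ => by positivity
    rw [mul_left_comm, inv_mul_le_iff₀ hlp]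
    nlinarith [mul_le_mul_of_nonneg_left h2 hK₁, mul_le_mul_of_nonneg_right hl₁ h3])
  obtain ⟨D, S₂, hD, hS₂, hS₂x⟩ := exists_tail_operator hq (f := fun k => x (σ k)) (g := g) hσa hxs
    (by simp_rw [hgpow q]; exact hys.mul_left _) B (by
    intro n hn
    have h1 : ∑' k, |y (τ (k + n))| ^ q ≤ K₂ * ∑' k, |x (σ (k + n))| ^ q := by
      refine ((summable_nat_add_iff n).2 hys).tsum_le_of_sum_le fun F => ?_
      have := hn (F.map (addRightEmbedding n)) (by simp)
      rwa [Finset.sum_map] at this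
    have h3 : 0 ≤ ∑' k, |x (σ (k + n))| ^ q := tsum_nonneg fun _ => by positivity
    have hlq : 0 < l ^ q := by positivity
    simp_rw [hgpow q]
    rw [tsum_mul_left, mul_left_comm, inv_mul_le_iff₀ hlq]
    nlinarith [mul_le_mul_of_nonneg_right hl₂ h3])
  obtain ⟨V, hV, hVy⟩ := exists_unrearrange hτ hτs
  have hU := fun t => mapsBdd_rearrange hσ t
  refine ⟨V ∘ₗ S₁ ∘ₗ wcomp 1 σ, V ∘ₗ D ∘ₗ wcomp 1 σ, V ∘ₗ S₂ ∘ₗ wcomp 1 σ,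
    fun t ht => (hV t).comp ((hS₁ t ht).comp (hU t)), fun t => (hV t).comp ((hD t).comp (hU t)),
    fun t ht => (hV t).comp ((hS₂ t ht).comp (hU t)), ?_⟩
  have hUx : wcomp 1 σ x = fun k => x (σ k) := by ext k; simp [wcomp_apply]
  simp only [LinearMap.comp_apply, hUx]
  rw [← map_add, ← map_add, hS₁x, hS₂x, Set.indicator_compl_add_self, ← map_smul]
  have : l • g = fun k => y (τ k) := by
    ext k
    simp only [hg, Pi.smul_apply, smul_eq_mul]
    field_simp
  rw [this, hVy]

/-- The counterpart of `exists_contractions` at the endpoint `∞`. -/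
theorem exists_contraction_of_top {p : ℝ} (hp : 0 < p) {C : ℝ} (hC : 0 ≤ C) :
    ∃ K : ℝ, ∀ x y : ℕ → ℝ, Filter.Tendsto x Filter.atTop (nhds 0) →
      Filter.Tendsto y Filter.atTop (nhds 0) →
      (∀ (F : Finset ℕ) (M : ℝ), (∀ k ∉ F, |x k| ≤ M) → ∃ a b : ℕ → ℝ, y = a + b ∧
        pw p a ≤ ENNReal.ofReal C * pw p ((F : Set ℕ).indicator x) ∧ ∀ k, |b k| ≤ C * M) →
      ∃ S : (ℕ → ℝ) →ₗ[ℝ] (ℕ → ℝ),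
        (∀ t, ENNReal.ofReal p ≤ t → MapsBdd S (ell t) 1) ∧ y = K • S x := by
  set K₁ : ℝ := 2 ^ p * (C + C ^ p)
  have hK₁ : 0 ≤ K₁ := by positivity
  set l : ℝ := max 1 ((8 * K₁) ^ (1 / p))
  have hl0 : 0 < l := one_pos.trans_le (le_max_left _ _)
  have hl₁ : 8 * K₁ ≤ l ^ p := le_rpow_of_rpow_inv_le hp (by positivity) (le_max_right _ _)
  refine ⟨l, fun x y hx hy hsplit => ?_⟩
  obtain ⟨σ, hσ, hσa, hσs⟩ := exists_antitone_rearrangement hx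
  obtain ⟨τ, hτ, hτa, hτs⟩ := exists_antitone_rearrangement hy
  have hhead : ∀ n, ∑ k ∈ Finset.range (n + 1), |y (τ k)| ^ p ≤
      K₁ * ∑ k ∈ Finset.range (n + 1), |x (σ k)| ^ p := by
    intro n
    -- Off the `n + 1` largest entries, `|x|` is at most `|x (σ n)|`. Hence `|b| ≤ C * |x (σ k)|`
    -- for every `k ≤ n`, so the head alternative holds for all `n`.
    obtain ⟨a, b, hab, ha, hb⟩ := hsplit ((Finset.range (n + 1)).map ⟨σ, hσ⟩) (|x (σ n)|) (by
      intro k hk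
      by_cases h0 : x k = 0
      · rw [h0, abs_zero]; exact abs_nonneg _
      obtain ⟨i, rfl⟩ := hσs k h0
      refine hσa ?_
      by_contra! hlt
      exact hk (Finset.mem_map_of_mem ⟨σ, hσ⟩ (Finset.mem_range.2 (by omega))))
    rw [pw_indicator_image hp hσ, ← ENNReal.ofReal_mul hC] at ha
    set H := ∑ k ∈ Finset.range (n + 1), |x (σ k)| ^ p
    have hH : 0 ≤ H := Finset.sum_nonneg fun _ _ => by positivity
    have h1 := sum_comp_le_of_pw_le hp (mul_nonneg hC hH) ha hτ (Finset.range (n + 1))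
    have h2 : ∀ k ∈ Finset.range (n + 1), |y (τ k)| ^ p ≤
        2 ^ p * (|a (τ k)| ^ p + C ^ p * |x (σ k)| ^ p) := by
      intro k hk
      have hbk : |b (τ k)| ≤ C * |x (σ k)| :=
        (hb _).trans (mul_le_mul_of_nonneg_left
          (hσa (Nat.lt_succ_iff.1 (Finset.mem_range.1 hk))) hC)
      have hy' : |y (τ k)| ≤ |a (τ k)| + C * |x (σ k)| := by
        rw [hab]; exact (abs_add_le _ _).trans (by linarith)
      have hcx : 0 ≤ C * |x (σ k)| := by positivity
      have hm : |y (τ k)| ≤ 2 * max (|a (τ k)|) (C * |x (σ k)|) := by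
        linarith [le_max_left (|a (τ k)|) (C * |x (σ k)|), le_max_right (|a (τ k)|) (C * |x (σ k)|)]
      refine (Real.rpow_le_rpow (abs_nonneg _) hm hp.le).trans ?_
      rw [Real.mul_rpow (by norm_num) (by positivity), ← Real.mul_rpow hC (abs_nonneg _)]
      refine mul_le_mul_of_nonneg_left ?_ (by positivity)
      have e1 : 0 ≤ |a (τ k)| ^ p := by positivity
      have e2 : 0 ≤ (C * |x (σ k)|) ^ p := by positivity
      rcases max_choice (|a (τ k)|) (C * |x (σ k)|) with h | h <;> rw [h] <;> linarith
    refine (Finset.sum_le_sum h2).trans ?_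
    rw [← Finset.mul_sum, Finset.sum_add_distrib, ← Finset.mul_sum, mul_assoc]
    refine mul_le_mul_of_nonneg_left ?_ (by positivity)
    change _ + C ^ p * H ≤ _
    linarith
  set g : ℕ → ℝ := fun k => l⁻¹ * y (τ k) with hg
  have hgabs : ∀ k, |g k| = l⁻¹ * |y (τ k)| := fun k => by
    rw [hg, abs_mul, abs_of_pos (inv_pos.2 hl0)]
  have hga : Antitone fun k => |g k| := fun i j h => by
    simp only [hgabs]
    exact mul_le_mul_of_nonneg_left (hτa h) (inv_pos.2 hl0).le
  obtain ⟨S, hS, hSx⟩ := exists_head_operator hp (f := fun k => x (σ k)) hga Set.univ (by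
    intro n _
    have hgpow : ∀ k, |g k| ^ p = (l ^ p)⁻¹ * |y (τ k)| ^ p := fun k => by
      rw [hgabs, Real.mul_rpow (inv_pos.2 hl0).le (abs_nonneg _), Real.inv_rpow hl0.le]
    simp_rw [hgpow]
    rw [← Finset.mul_sum]
    have hlp : 0 < l ^ p := by positivity
    have h3 : 0 ≤ ∑ k ∈ Finset.range (n + 1), |x (σ k)| ^ p :=
      Finset.sum_nonneg fun _ _ => by positivity
    rw [mul_left_comm, inv_mul_le_iff₀ hlp]
    nlinarith [hhead n, mul_le_mul_of_nonneg_right hl₁ h3])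
  obtain ⟨V, hV, hVy⟩ := exists_unrearrange hτ hτs
  refine ⟨V ∘ₗ S ∘ₗ wcomp 1 σ,
    fun t ht => (hV t).comp ((hS t ht).comp (mapsBdd_rearrange hσ t)), ?_⟩
  have hUx : wcomp 1 σ x = fun k => x (σ k) := by ext k; simp [wcomp_apply]
  simp only [LinearMap.comp_apply, hUx]
  rw [hSx, Set.indicator_univ, ← map_smul]
  have : l • g = fun k => y (τ k) := by
    ext k
    simp only [hg, Pi.smul_apply, smul_eq_mul]
    field_simp
  rw [this, hVy]

/-! ### Decomposition of bounded operators. -/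

theorem pw_mono {t : ℝ} (ht : 0 ≤ t) {u v : ℕ → ℝ} (h : ∀ k, ‖u k‖ₑ ≤ ‖v k‖ₑ) :
    pw t u ≤ pw t v :=
  ENNReal.tsum_le_tsum fun k => ENNReal.rpow_le_rpow (h k) ht

theorem pw_indicator_le {t : ℝ} (ht : 0 ≤ t) (s : Set ℕ) (z : ℕ → ℝ) :
    pw t (s.indicator z) ≤ pw t z :=
  pw_mono ht fun k => by by_cases h : k ∈ s <;> simp [h]

theorem enorm_rpow_le_pw (t : ℝ) (z : ℕ → ℝ) (k : ℕ) : ‖z k‖ₑ ^ t ≤ pw t z :=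
  ENNReal.le_tsum k

theorem pw_le_pw_rpow {s t : ℝ} (hs : 0 < s) (hst : s ≤ t) (z : ℕ → ℝ) :
    pw t z ≤ pw s z ^ (t / s) := by
  have ht : 0 < t := hs.trans_le hst
  rw [pw_le_iff_sum]
  intro F
  have h1 : (∑ k ∈ F, ‖z k‖ₑ ^ t) ^ (s / t) ≤ pw s z := by
    refine (sum_rpow_le_rpow_sum (by positivity) ((div_le_one ht).2 hst) F _).trans ?_
    refine le_trans (Finset.sum_congr rfl fun k _ => ?_).le (ENNReal.sum_le_tsum F)
    rw [← ENNReal.rpow_mul, mul_div_cancel₀ _ ht.ne']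
  calc ∑ k ∈ F, ‖z k‖ₑ ^ t = ((∑ k ∈ F, ‖z k‖ₑ ^ t) ^ (s / t)) ^ (t / s) := by
        rw [← ENNReal.rpow_mul, div_mul_div_cancel₀ ht.ne', div_self hs.ne', ENNReal.rpow_one]
    _ ≤ _ := by gcongr

theorem pw_ne_top_mono {s t : ℝ} (hs : 0 < s) (hst : s ≤ t) {z : ℕ → ℝ} (h : pw s z ≠ ⊤) :
    pw t z ≠ ⊤ :=
  ne_top_of_le_ne_top
    (ENNReal.rpow_ne_top_of_nonneg (div_nonneg (hs.le.trans hst) hs.le) h)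
    (pw_le_pw_rpow hs hst z)

theorem pw_single {t : ℝ} (ht : 0 < t) (j : ℕ) : pw t (Pi.single j 1) = 1 := by
  unfold pw
  rw [tsum_eq_single j]
  · simp
  · intro k hk
    simp [Pi.single_eq_of_ne hk, ht]

theorem indicator_eq_sum_single (F : Finset ℕ) (z : ℕ → ℝ) :
    (F : Set ℕ).indicator z = ∑ j ∈ F, z j • (Pi.single j 1 : ℕ → ℝ) := by
  classical
  ext k
  rw [Finset.sum_apply]
  simp [Pi.single_apply, Set.indicator_apply]

/-- Operators bounded on `ℓ^q` are determined, coordinatewise, by truncations. -/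
theorem tendsto_apply_truncation {q c : ℝ} (hq : 0 < q) (hc : 0 ≤ c)
    {T : (ℕ → ℝ) →ₗ[ℝ] (ℕ → ℝ)} (hT : ∀ z, pw q (T z) ≤ ENNReal.ofReal c * pw q z)
    {z : ℕ → ℝ} (hz : pw q z ≠ ⊤) (k : ℕ) :
    Filter.Tendsto (fun n => T ((Finset.range n : Set ℕ).indicator z) k) Filter.atTop
      (nhds (T z k)) := by
  rw [tendsto_iff_norm_sub_tendsto_zero]
  have htail : Filter.Tendsto (fun n => (c * ∑' k, |z (k + n)| ^ q) ^ (1 / q)) Filter.atTop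
      (nhds 0) := by
    have h := ((tendsto_sum_nat_add fun k => |z k| ^ q).const_mul c).rpow_const (p := 1 / q)
      (Or.inr (by positivity))
    rwa [mul_zero, Real.zero_rpow (by positivity)] at h
  refine squeeze_zero (fun _ => norm_nonneg _) (fun n => ?_) htail
  have h1 : T ((Finset.range n : Set ℕ).indicator z) k - T z k =
      - T ((Finset.range n : Set ℕ)ᶜ.indicator z) k := by
    conv_lhs => rw [← Set.indicator_self_add_compl (Finset.range n : Set ℕ) z]
    rw [map_add, Set.indicator_self_add_compl, Pi.add_apply]
    ring
  have h2 := (enorm_rpow_le_pw q (T ((Finset.range n : Set ℕ)ᶜ.indicator z)) k).trans (hT _)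
  have h3 := pw_indicator_image_compl hq hz (σ := id) Function.injective_id (by simp) n
  have h4 : ((Finset.range n).map ⟨id, Function.injective_id⟩ : Set ℕ) = (Finset.range n : Set ℕ) := by
    ext; simp
  rw [h4] at h3
  simp only [id] at h3
  have h5 : 0 ≤ ∑' k, |z (k + n)| ^ q := tsum_nonneg fun _ => by positivity
  rw [h3, ← ENNReal.ofReal_mul hc, enorm_rpow_eq_ofReal hq,
    ENNReal.ofReal_le_ofReal_iff (mul_nonneg hc h5)] at h2
  rw [h1, norm_neg, Real.norm_eq_abs]
  have := Real.rpow_le_rpow (by positivity) h2 (show 0 ≤ 1 / q by positivity)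
  rwa [← Real.rpow_mul (abs_nonneg _), mul_one_div_cancel hq.ne', Real.rpow_one] at this

/-- For `t ≤ 1`, boundedness on `ℓ^t` can be tested on the unit vectors. -/
theorem pw_le_of_columns {q c t : ℝ} (hq : 0 < q) (hc : 0 ≤ c) (ht : 0 < t) (ht1 : t ≤ 1)
    {T : (ℕ → ℝ) →ₗ[ℝ] (ℕ → ℝ)} (hT : ∀ z, pw q (T z) ≤ ENNReal.ofReal c * pw q z)
    {M : ℝ≥0∞} (hM : ∀ j, pw t (T (Pi.single j 1)) ≤ M) {z : ℕ → ℝ} (hz : pw q z ≠ ⊤) :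
    pw t (T z) ≤ M * pw t z := by
  have hfin : ∀ n, pw t (T ((Finset.range n : Set ℕ).indicator z)) ≤ M * pw t z := by
    intro n
    rw [indicator_eq_sum_single, map_sum, pw_le_iff_sum]
    intro F
    calc ∑ k ∈ F, ‖(∑ j ∈ Finset.range n, T (z j • Pi.single j 1)) k‖ₑ ^ t
        ≤ ∑ k ∈ F, ∑ j ∈ Finset.range n, ‖z j‖ₑ ^ t * ‖T (Pi.single j 1) k‖ₑ ^ t := by
          refine Finset.sum_le_sum fun k _ => ?_
          rw [Finset.sum_apply]
          calc ‖∑ j ∈ Finset.range n, T (z j • Pi.single j 1) k‖ₑ ^ t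
              ≤ (∑ j ∈ Finset.range n, ‖T (z j • Pi.single j 1) k‖ₑ) ^ t := by
                gcongr
                exact enorm_sum_le _ _
            _ ≤ ∑ j ∈ Finset.range n, ‖T (z j • Pi.single j 1) k‖ₑ ^ t :=
                sum_rpow_le_rpow_sum ht ht1 _ _
            _ = _ := by
                refine Finset.sum_congr rfl fun j _ => ?_
                rw [map_smul, Pi.smul_apply, smul_eq_mul, enorm_mul,
                  ENNReal.mul_rpow_of_nonneg _ _ ht.le]
      _ = ∑ j ∈ Finset.range n, ‖z j‖ₑ ^ t * ∑ k ∈ F, ‖T (Pi.single j 1) k‖ₑ ^ t := by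
          rw [Finset.sum_comm]
          exact Finset.sum_congr rfl fun j _ => by rw [Finset.mul_sum]
      _ ≤ ∑ j ∈ Finset.range n, ‖z j‖ₑ ^ t * M := by
          gcongr with j
          exact pw_le_iff_sum.1 (hM j) F
      _ ≤ M * pw t z := by
          rw [← Finset.sum_mul, mul_comm]
          gcongr
          exact ENNReal.sum_le_tsum _
  rw [pw_le_iff_sum]
  intro F
  -- A finite set of coordinates at a time, the bound survives the limit of truncations.
  refine le_of_tendsto' (x := Filter.atTop) (tendsto_finsetSum F fun k _ => ?_)
    fun n => pw_le_iff_sum.1 (hfin n) F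
  exact (((ENNReal.continuous_rpow_const (y := t)).comp continuous_enorm).tendsto _).comp
    (tendsto_apply_truncation hq hc hT hz k)

theorem exists_contractions_of_bdd {p q : ℝ} (hp : 0 < p) (hpq : p < q) {c d : ℝ} (hc : 0 ≤ c)
    (hd : 0 ≤ d) {T : (ℕ → ℝ) →ₗ[ℝ] (ℕ → ℝ)} (hTp : ∀ z, pw p (T z) ≤ ENNReal.ofReal c * pw p z)
    (hTq : ∀ z, pw q (T z) ≤ ENNReal.ofReal d * pw q z) :
    ∃ K : ℝ, ∀ x : ℕ → ℝ, pw q x ≠ ⊤ → ∃ S₁ D S₂ : (ℕ → ℝ) →ₗ[ℝ] (ℕ → ℝ),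
      (∀ t, ENNReal.ofReal p ≤ t → MapsBdd S₁ (ell t) 1) ∧ (∀ t, MapsBdd D (ell t) 1) ∧
      (∀ t, t ≤ ENNReal.ofReal q → MapsBdd S₂ (ell t) 1) ∧
      T x = K • (S₁ x + (D x + S₂ x)) := by
  have hq : 0 < q := hp.trans hpq
  -- The decomposition needs `q ≥ 1`. For `q < 1` the columns of `T` are bounded in `ℓ^q`, hence in
  -- `ℓ¹`, so `q` may be replaced by 1.
  obtain ⟨q', hqq', hq'1, e, he, hTq'⟩ : ∃ q', q ≤ q' ∧ 1 ≤ q' ∧ ∃ e : ℝ, 0 ≤ e ∧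
      ∀ z, pw q z ≠ ⊤ → pw q' (T z) ≤ ENNReal.ofReal e * pw q' z := by
    rcases le_or_gt 1 q with h1 | h1
    · exact ⟨q, le_rfl, h1, d, hd, fun z _ => hTq z⟩
    · refine ⟨1, h1.le, le_rfl, d ^ (1 / q), by positivity, fun z hz => ?_⟩
      refine pw_le_of_columns hq hd one_pos le_rfl hTq (fun j => ?_) hz
      refine (pw_le_pw_rpow hq h1.le _).trans ?_
      rw [← ENNReal.ofReal_rpow_of_nonneg hd (by positivity)]
      gcongr
      simpa [pw_single hq] using hTq (Pi.single j 1)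
  obtain ⟨K, hK⟩ := exists_contractions hp (hpq.trans_le hqq') hq'1 (add_nonneg hc he)
  refine ⟨K, fun x hx => ?_⟩
  have hx' := pw_ne_top_mono hq hqq' hx
  obtain ⟨S₁, D, S₂, h1, h2, h3, h4⟩ := hK x (T x) hx'
    (ne_top_of_le_ne_top (ENNReal.mul_ne_top ENNReal.ofReal_ne_top hx') (hTq' x hx)) (fun F => by
      refine ⟨T ((F : Set ℕ).indicator x), T ((F : Set ℕ)ᶜ.indicator x), ?_, ?_, ?_⟩
      · rw [← map_add, Set.indicator_self_add_compl]
      · refine (hTp _).trans ?_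
        gcongr
        linarith
      · refine (hTq' _ (ne_top_of_le_ne_top hx (pw_indicator_le hq.le _ _))).trans ?_
        gcongr
        linarith)
  exact ⟨S₁, D, S₂, h1, h2, fun t ht => h3 t (ht.trans (ENNReal.ofReal_le_ofReal hqq')), h4⟩

/-- A long truncation of `x` has its image in `ℓ^p`, which tends to zero, and the remainder has a
uniformly small image. -/
theorem tendsto_apply_zero_of_top {p c d : ℝ} (hp : 0 < p) (hd : 0 ≤ d)
    {T : (ℕ → ℝ) →ₗ[ℝ] (ℕ → ℝ)} (hTp : ∀ z, pw p (T z) ≤ ENNReal.ofReal c * pw p z)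
    (hTtop : ∀ (z : ℕ → ℝ) (M : ℝ), (∀ k, |z k| ≤ M) → ∀ k, |T z k| ≤ d * M) {x : ℕ → ℝ}
    (hx : Filter.Tendsto x Filter.atTop (nhds 0)) :
    Filter.Tendsto (T x) Filter.atTop (nhds 0) := by
  rw [Metric.tendsto_atTop] at hx ⊢
  intro ε hε
  obtain ⟨N, hN⟩ := hx (ε / (2 * (d + 1))) (by positivity)
  have h1 : ∀ k, |T ((Finset.range N : Set ℕ)ᶜ.indicator x) k| ≤ ε / 2 := by
    intro k
    refine (hTtop _ (ε / (2 * (d + 1))) (fun j => ?_) k).trans ?_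
    · by_cases hj : j < N
      · rw [Set.indicator_of_notMem (by simpa using hj), abs_zero]; positivity
      · rw [Set.indicator_of_mem (by simpa using hj)]
        have := (hN j (not_lt.1 hj)).le
        rwa [Real.dist_0_eq_abs] at this
    · rw [mul_div_assoc', div_le_div_iff₀ (by positivity) (by norm_num)]
      nlinarith
  have hfin : pw p (T ((Finset.range N : Set ℕ).indicator x)) ≠ ⊤ := by
    refine ne_top_of_le_ne_top (ENNReal.mul_ne_top ENNReal.ofReal_ne_top ?_) (hTp _)
    unfold pw
    rw [tsum_eq_sum (s := Finset.range N)]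
    · exact ENNReal.sum_ne_top.2 fun k _ => ENNReal.rpow_ne_top_of_nonneg hp.le enorm_ne_top
    · intro k hk
      rw [Set.indicator_of_notMem (by simpa using hk)]
      simp [hp]
  obtain ⟨N', hN'⟩ := Metric.tendsto_atTop.1 (tendsto_zero_of_pw hp hfin) (ε / 2) (by positivity)
  refine ⟨N', fun k hk => ?_⟩
  have h2 := hN' k hk
  rw [Real.dist_0_eq_abs] at h2 ⊢
  rw [← Set.indicator_self_add_compl (Finset.range N : Set ℕ) x, map_add, Pi.add_apply]
  exact (abs_add_le _ _).trans_lt (by linarith [h1 k])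

theorem exists_contraction_of_bdd_top {p : ℝ} (hp : 0 < p) {c d : ℝ} (hc : 0 ≤ c) (hd : 0 ≤ d)
    {T : (ℕ → ℝ) →ₗ[ℝ] (ℕ → ℝ)} (hTp : ∀ z, pw p (T z) ≤ ENNReal.ofReal c * pw p z)
    (hTtop : ∀ (z : ℕ → ℝ) (M : ℝ), (∀ k, |z k| ≤ M) → ∀ k, |T z k| ≤ d * M) :
    ∃ K : ℝ, ∀ x : ℕ → ℝ, Filter.Tendsto x Filter.atTop (nhds 0) →
      ∃ S : (ℕ → ℝ) →ₗ[ℝ] (ℕ → ℝ),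
        (∀ t, ENNReal.ofReal p ≤ t → MapsBdd S (ell t) 1) ∧ T x = K • S x := by
  obtain ⟨K, hK⟩ := exists_contraction_of_top hp (add_nonneg hc hd)
  refine ⟨K, fun x hx => hK x (T x) hx (tendsto_apply_zero_of_top hp hd hTp hTtop hx) ?_⟩
  intro F M hM
  refine ⟨T ((F : Set ℕ).indicator x), T ((F : Set ℕ)ᶜ.indicator x), ?_, ?_, fun k => ?_⟩
  · rw [← map_add, Set.indicator_self_add_compl]
  · refine (hTp _).trans ?_
    gcongr
    linarith
  · obtain ⟨j, hj⟩ := Infinite.exists_notMem_finset F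
    have hM0 : 0 ≤ M := (abs_nonneg _).trans (hM j hj)
    refine (hTtop _ M (fun i => ?_) k).trans (by nlinarith)
    by_cases hi : i ∈ F
    · rw [Set.indicator_of_notMem (by simpa using hi), abs_zero]; exact hM0
    · rw [Set.indicator_of_mem (by simpa using hi)]; exact hM i hi

/-! ### Baire category and closed graph in quasi-Banach spaces. -/

namespace QuasiNormedSeqSpace

theorem exists_qnorm_add_le_one_le (X : QuasiNormedSeqSpace) :
    ∃ C : ℝ, 1 ≤ C ∧ ∀ x y, X.qnorm (x + y) ≤ C * (X.qnorm x + X.qnorm y) := by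
  obtain ⟨C, hC⟩ := X.exists_qnorm_add_le
  refine ⟨max C 1, le_max_right _ _, fun x y => (hC x y).trans ?_⟩
  exact mul_le_mul_of_nonneg_right (le_max_left _ _)
    (add_nonneg (X.qnorm_nonneg x) (X.qnorm_nonneg y))

theorem qnorm_zero (X : QuasiNormedSeqSpace) : X.qnorm 0 = 0 := (X.qnorm_eq_zero_iff 0).2 rfl

theorem qnorm_sub_comm (X : QuasiNormedSeqSpace) (x y : X.carrier) :
    X.qnorm (x - y) = X.qnorm (y - x) := by
  rw [← X.qnorm_neg, neg_sub]

theorem qnorm_sub_le {X : QuasiNormedSeqSpace} {C : ℝ}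
    (hC : ∀ x y, X.qnorm (x + y) ≤ C * (X.qnorm x + X.qnorm y)) (x y z : X.carrier) :
    X.qnorm (x - z) ≤ C * (X.qnorm (x - y) + X.qnorm (y - z)) := by
  have := hC (x - y) (y - z)
  rwa [sub_add_sub_cancel] at this

/-- A sequence whose increments decrease fast enough converges, with an explicit rate. -/
theorem exists_limit_of_fast {X : QuasiNormedSeqSpace} (hX : X.IsQuasiBanach) {C : ℝ}
    (hC1 : 1 ≤ C) (hC : ∀ x y, X.qnorm (x + y) ≤ C * (X.qnorm x + X.qnorm y))
    {y : ℕ → X.carrier} {ρ : ℕ → ℝ} (hρ : ∀ n, 0 < ρ n)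
    (hρs : ∀ n, ρ (n + 1) ≤ ρ n / (2 * C))
    (hy : ∀ n, X.qnorm (y (n + 1) - y n) ≤ ρ n / (2 * C)) :
    ∃ v, Filter.Tendsto (fun n => X.qnorm (y n - v)) Filter.atTop (nhds 0) ∧
      ∀ n, X.qnorm (v - y n) ≤ 2 * C * ρ n := by
  have hC0 : 0 < C := by linarith
  have hchain : ∀ d n, X.qnorm (y (n + d) - y n) ≤ ρ n := by
    intro d
    induction d with
    | zero => intro n; simpa [X.qnorm_zero] using (hρ n).le
    | succ d ih =>
      intro n
      refine (qnorm_sub_le hC _ (y (n + 1)) _).trans ?_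
      have h1 := ih (n + 1)
      rw [show n + 1 + d = n + (d + 1) by ring] at h1
      calc C * (_ + _) ≤ C * (ρ n / (2 * C) + ρ n / (2 * C)) := by
            gcongr
            · exact h1.trans (hρs n)
            · exact hy n
        _ = ρ n := by field_simp; ring
  have hchain' : ∀ n m, n ≤ m → X.qnorm (y m - y n) ≤ ρ n := fun n m h => by
    have := hchain (m - n) n
    rwa [Nat.add_sub_cancel' h] at this
  have hρ0 : Filter.Tendsto ρ Filter.atTop (nhds 0) := by
    have hle : ∀ n, ρ n ≤ ρ 0 * (1 / 2) ^ n := by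
      intro n
      induction n with
      | zero => simp
      | succ n ih =>
        have h1 : ρ n / (2 * C) ≤ ρ n / 2 := by
          have := (hρ n).le
          gcongr
          linarith
        rw [pow_succ]
        linarith [hρs n]
    refine squeeze_zero (fun n => (hρ n).le) hle ?_
    simpa using (tendsto_pow_atTop_nhds_zero_of_lt_one (by norm_num : (0 : ℝ) ≤ 1 / 2)
      (by norm_num)).const_mul (ρ 0)
  obtain ⟨v, hv⟩ := hX.2 y (fun ε hε => by
    obtain ⟨N, hN⟩ := (hρ0.eventually (gt_mem_nhds (show 0 < ε / (2 * C) by positivity))).exists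
    refine ⟨N, fun m n hm hn => (qnorm_sub_le hC _ (y N) _).trans_lt ?_⟩
    rw [X.qnorm_sub_comm (y N)]
    calc C * (_ + _) ≤ C * (ρ N + ρ N) := by gcongr <;> exact hchain' _ _ (by assumption)
      _ < C * (ε / (2 * C) + ε / (2 * C)) := by gcongr
      _ = ε := by field_simp; ring)
  refine ⟨v, hv, fun n => ?_⟩
  obtain ⟨m, hm, hnm⟩ := ((hv.eventually (gt_mem_nhds (hρ n))).and
    (Filter.eventually_ge_atTop n)).exists
  refine (qnorm_sub_le hC _ (y m) _).trans ?_
  rw [X.qnorm_sub_comm v]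
  nlinarith [hchain' n m hnm]

/-- The Baire category theorem in a quasi-Banach space. -/
theorem exists_dense_in_ball {X : QuasiNormedSeqSpace} (hX : X.IsQuasiBanach)
    (E : ℕ → Set X.carrier) (hE : ∀ x, ∃ n, x ∈ E n) :
    ∃ n x₀ ρ, 0 < ρ ∧ ∀ x, X.qnorm (x - x₀) < ρ → ∀ ε > 0, ∃ u ∈ E n, X.qnorm (x - u) < ε := by
  obtain ⟨C, hC1, hC⟩ := X.exists_qnorm_add_le_one_le
  have hC0 : 0 < C := by linarith
  by_contra! hcon
  have hstep : ∀ (n : ℕ) (s : X.carrier × {ρ : ℝ // 0 < ρ}), ∃ s' : X.carrier × {ρ : ℝ // 0 < ρ},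
      X.qnorm (s'.1 - s.1) ≤ s.2.1 / (2 * C) ∧ s'.2.1 ≤ s.2.1 / (2 * C) ∧
      ∀ u ∈ E n, 2 * C * s'.2.1 < X.qnorm (s'.1 - u) := by
    rintro n ⟨x, ρ, hρ⟩
    -- Points within `2 * C` times the new radius of `x'` avoid `E n`, and the limit of the
    -- construction is such a point.
    obtain ⟨x', hx', ε, hε, hu⟩ := hcon n x (ρ / (2 * C)) (by positivity)
    refine ⟨⟨x', min (ρ / (2 * C)) (ε / (4 * C)), by positivity⟩, hx'.le, min_le_left _ _,
      fun u hu' => lt_of_lt_of_le ?_ (hu u hu')⟩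
    calc 2 * C * min (ρ / (2 * C)) (ε / (4 * C)) ≤ 2 * C * (ε / (4 * C)) := by
          gcongr; exact min_le_right _ _
      _ = ε / 2 := by field_simp; ring
      _ < ε := by linarith
  choose f hf1 hf2 hf3 using hstep
  let s : ℕ → X.carrier × {ρ : ℝ // 0 < ρ} := fun n => Nat.rec (0, ⟨1, one_pos⟩) f n
  obtain ⟨v, -, hv⟩ := exists_limit_of_fast hX hC1 hC (y := fun n => (s n).1)
    (ρ := fun n => (s n).2.1) (fun n => (s n).2.2) (fun n => hf2 n (s n)) (fun n => hf1 n (s n))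
  obtain ⟨n, hn⟩ := hE v
  have h1 := hf3 n (s n) v hn
  have h2 := hv (n + 1)
  rw [X.qnorm_sub_comm] at h2
  exact absurd h2 (not_le.2 h1)

/-- The closed graph theorem in a quasi-Banach space. -/
theorem exists_qnorm_le_of_closed_graph {X : QuasiNormedSeqSpace} (hX : X.IsQuasiBanach)
    (S : X.carrier →ₗ[ℝ] X.carrier)
    (hS : ∀ (u : ℕ → X.carrier) (x v : X.carrier),
      Filter.Tendsto (fun n => X.qnorm (u n - x)) Filter.atTop (nhds 0) →
      Filter.Tendsto (fun n => X.qnorm (S (u n) - v)) Filter.atTop (nhds 0) → v = S x) :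
    ∃ K : ℝ, ∀ x, X.qnorm (S x) ≤ K * X.qnorm x := by
  obtain ⟨C, hC1, hC⟩ := X.exists_qnorm_add_le_one_le
  have hC0 : 0 < C := by linarith
  obtain ⟨n, x₀, ρ, hρ, hball⟩ := exists_dense_in_ball hX (fun n : ℕ => {x | X.qnorm (S x) ≤ n})
    (fun x => exists_nat_ge (X.qnorm (S x)))
  set M : ℝ := C * (n + n) + 1
  have hM : 0 < M := by positivity
  -- Differences of points of the level set carry density near `x₀` to density near 0.
  have happrox : ∀ x, X.qnorm x < ρ → ∀ ε > 0, ∃ w, X.qnorm (x - w) ≤ ε ∧ X.qnorm (S w) ≤ M := by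
    intro x hx ε hε
    obtain ⟨u, hu, hu'⟩ := hball (x + x₀) (by simpa using hx) (ε / (2 * C)) (by positivity)
    obtain ⟨v, hv, hv'⟩ := hball x₀ (by simpa [X.qnorm_zero] using hρ) (ε / (2 * C)) (by positivity)
    refine ⟨u - v, ?_, ?_⟩
    · have h := hC (x + x₀ - u) (-(x₀ - v))
      rw [X.qnorm_neg] at h
      rw [show x - (u - v) = x + x₀ - u + -(x₀ - v) by abel]
      refine h.trans ?_
      calc C * (_ + _) ≤ C * (ε / (2 * C) + ε / (2 * C)) := by gcongr
        _ = ε := by field_simp; ring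
    · have h := hC (S u) (-(S v))
      rw [X.qnorm_neg] at h
      rw [map_sub, sub_eq_add_neg]
      refine h.trans ?_
      have hu : X.qnorm (S u) ≤ n := hu
      have hv : X.qnorm (S v) ≤ n := hv
      have : C * (X.qnorm (S u) + X.qnorm (S v)) ≤ C * (n + n) := by gcongr
      linarith
  set θ : ℝ := 1 / (2 * C) with hθdef
  have hθ : 0 < θ := by positivity
  have hstep : ∀ (n : ℕ) (r : X.carrier), ∃ w, X.qnorm r ≤ θ ^ n * (ρ / 2) →
      X.qnorm (r - w) ≤ θ ^ (n + 1) * (ρ / 2) ∧ X.qnorm (S w) ≤ θ ^ n * M := by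
    intro n r
    by_cases hr : X.qnorm r ≤ θ ^ n * (ρ / 2)
    · have hθn : 0 < θ ^ n := by positivity
      obtain ⟨w, hw, hw'⟩ := happrox ((θ ^ n)⁻¹ • r) (by
        rw [hX.1, abs_of_pos (by positivity), inv_mul_lt_iff₀ hθn]
        refine hr.trans_lt ?_
        gcongr
        linarith) (θ * (ρ / 2)) (by positivity)
      refine ⟨θ ^ n • w, fun _ => ⟨?_, ?_⟩⟩
      · have h1 : r - θ ^ n • w = θ ^ n • ((θ ^ n)⁻¹ • r - w) := by
          rw [smul_sub, smul_inv_smul₀ hθn.ne']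
        rw [h1, hX.1, abs_of_pos hθn, pow_succ, mul_assoc]
        gcongr
      · rw [map_smul, hX.1, abs_of_pos hθn]
        gcongr
    · exact ⟨0, fun h => absurd h hr⟩
  choose w hw using hstep
  have hbdd : ∀ x, X.qnorm x ≤ ρ / 2 → X.qnorm (S x) ≤ 2 * C * (2 * C * M) := by
    intro x hx
    -- Successive approximation: `r n` is the remainder, and the ratio `θ = 1 / (2 * C)` is what
    -- `exists_limit_of_fast` requires of the images.
    let r : ℕ → X.carrier := fun n => Nat.rec x (fun n r => r - w n r) n
    have hrs : ∀ n, r (n + 1) = r n - w n (r n) := fun n => rfl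
    have hr : ∀ n, X.qnorm (r n) ≤ θ ^ n * (ρ / 2) := by
      intro n
      induction n with
      | zero => rw [pow_zero, one_mul]; exact hx
      | succ n ih => rw [hrs]; exact (hw n _ ih).1
    have hθ1 : θ < 1 := by
      rw [hθdef, div_lt_one (by positivity)]; linarith
    have hr0 : Filter.Tendsto (fun n => X.qnorm (x - r n - x)) Filter.atTop (nhds 0) := by
      refine squeeze_zero (fun n => X.qnorm_nonneg _) (fun n => ?_)
        (by simpa using (tendsto_pow_atTop_nhds_zero_of_lt_one hθ.le hθ1).mul_const (ρ / 2))
      rw [sub_sub_cancel_left, X.qnorm_neg]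
      exact hr n
    obtain ⟨v, hv, hv'⟩ := exists_limit_of_fast hX hC1 hC (y := fun n => S (x - r n))
      (ρ := fun n => 2 * C * M * θ ^ n) (fun n => by positivity)
      (fun n => by rw [pow_succ, hθdef]; apply le_of_eq; field_simp)
      (fun n => by
        rw [← map_sub, hrs, show x - (r n - w n (r n)) - (x - r n) = w n (r n) by abel]
        refine (hw n _ (hr n)).2.trans (le_of_eq ?_)
        field_simp)
    have h0 := hv' 0
    rw [hS _ x v hr0 hv] at h0
    simpa [r] using h0
  refine ⟨2 * C * (2 * C * M) * (2 / ρ), fun x => ?_⟩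
  rcases (X.qnorm_nonneg x).eq_or_lt with h0 | hpos
  · have : x = 0 := (X.qnorm_eq_zero_iff x).1 h0.symm
    simp [this, X.qnorm_zero]
  · set a : ℝ := ρ / 2 / X.qnorm x with ha
    have ha0 : 0 < a := by positivity
    have h1 := hbdd (a • x) (by
      rw [hX.1, abs_of_pos ha0, ha, div_mul_cancel₀ _ hpos.ne'])
    rw [map_smul, hX.1, abs_of_pos ha0] at h1
    have h2 : X.qnorm (S x) ≤ 2 * C * (2 * C * M) / a := by
      rw [le_div_iff₀ ha0]; linarith
    refine h2.trans (le_of_eq ?_)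
    rw [ha]
    field_simp

end QuasiNormedSeqSpace

/-! ### The couples `ℓˢ ⊆ ℓᵗ`. -/

theorem ell_qnorm_smul {t : ℝ≥0∞} (ht : t ≠ 0) (a : ℝ) (x : (ell t).carrier) :
    (ell t).qnorm (a • x) = |a| * (ell t).qnorm x :=
  lp.norm_const_smul ht (c := a) (⟨x.1, x.2⟩ : lp (fun _ : ℕ => ℝ) t)

theorem abs_apply_le_ell_qnorm {t : ℝ≥0∞} (ht : t ≠ 0) (x : (ell t).carrier) (k : ℕ) :
    |(x : ℕ → ℝ) k| ≤ (ell t).qnorm x :=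
  lp.norm_apply_le_norm ht (⟨x.1, x.2⟩ : lp (fun _ : ℕ => ℝ) t) k

theorem ell_qnorm_mono {s t : ℝ≥0∞} (hs : s ≠ 0) (hst : s ≤ t) {x : ℕ → ℝ}
    (hx : x ∈ (ell s).carrier) (hx' : x ∈ (ell t).carrier) :
    (ell t).qnorm ⟨x, hx'⟩ ≤ (ell s).qnorm ⟨x, hx⟩ := by
  rcases eq_or_ne t ⊤ with rfl | ht
  · exact lp.norm_le_of_forall_le' (f := (⟨x, hx'⟩ : lp (fun _ : ℕ => ℝ) ⊤)) _
      fun k => abs_apply_le_ell_qnorm hs ⟨x, hx⟩ k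
  · have hs' : s ≠ ⊤ := ne_top_of_le_ne_top ht hst
    have hs0 := pos_iff_ne_zero.2 hs
    have hn := (ell s).qnorm_nonneg ⟨x, hx⟩
    have hsr := ENNReal.toReal_pos hs hs'
    have hstr := ENNReal.toReal_mono ht hst
    rw [ell_qnorm_le_iff (hs0.trans_le hst) ht hx' hn]
    refine (pw_le_pw_rpow hsr hstr x).trans ?_
    rw [← ENNReal.ofReal_toReal ((mem_ell_iff_pw hs0 hs').1 hx), ← ell_qnorm_rpow hs0 hs' hx,
      ENNReal.ofReal_rpow_of_nonneg (by positivity) (by positivity), ← Real.rpow_mul hn,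
      mul_div_cancel₀ _ hsr.ne']

/-- `X ⊆ Y` with continuous inclusion. -/
def ContIncl (X Y : QuasiNormedSeqSpace) : Prop :=
  ∃ h : X.carrier ≤ Y.carrier, ∀ ε : ℝ, 0 < ε → ∃ δ : ℝ, 0 < δ ∧
    ∀ x : X.carrier, X.qnorm x < δ → Y.qnorm ⟨x, h x.2⟩ < ε

theorem ContIncl.trans {X Y Z : QuasiNormedSeqSpace} (hXY : ContIncl X Y) (hYZ : ContIncl Y Z) :
    ContIncl X Z := by
  obtain ⟨h₁, h₁'⟩ := hXY
  obtain ⟨h₂, h₂'⟩ := hYZ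
  refine ⟨h₁.trans h₂, fun ε hε => ?_⟩
  obtain ⟨δ, hδ, hδ'⟩ := h₂' ε hε
  obtain ⟨η, hη, hη'⟩ := h₁' δ hδ
  exact ⟨η, hη, fun x hx => hδ' _ (hη' x hx)⟩

theorem ContIncl.tendsto {X Y : QuasiNormedSeqSpace} {h : X.carrier ≤ Y.carrier}
    (hXY : ∀ ε : ℝ, 0 < ε → ∃ δ : ℝ, 0 < δ ∧
      ∀ x : X.carrier, X.qnorm x < δ → Y.qnorm ⟨x, h x.2⟩ < ε) {u : ℕ → X.carrier}
    (hu : Filter.Tendsto (fun n => X.qnorm (u n)) Filter.atTop (nhds 0)) :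
    Filter.Tendsto (fun n => Y.qnorm ⟨u n, h (u n).2⟩) Filter.atTop (nhds 0) := by
  rw [tendsto_order]
  refine ⟨fun a ha => Filter.Eventually.of_forall fun n => ha.trans_le (Y.qnorm_nonneg _),
    fun ε hε => ?_⟩
  obtain ⟨δ, hδ, hδ'⟩ := hXY ε hε
  filter_upwards [hu.eventually (gt_mem_nhds hδ)] with n hn
  exact hδ' _ hn

theorem contIncl_ell {s t : ℝ≥0∞} (hst : s ≤ t) : ContIncl (ell s) (ell t) := by
  refine ⟨fun x hx => Memℓp.of_exponent_ge hx hst, fun ε hε => ?_⟩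
  rcases eq_or_ne s 0 with rfl | hs
  -- `ℓ⁰` is discrete: fewer than one nonzero entry means zero.
  · refine ⟨1, one_pos, fun x hx => ?_⟩
    have h0 : x = 0 := by
      rw [← (ell 0).qnorm_eq_zero_iff]
      rw [show x = ⟨x.1, x.2⟩ from rfl, ell_zero_qnorm] at hx ⊢
      have : ({k | (x : ℕ → ℝ) k ≠ 0} : Set ℕ).ncard < 1 := by exact_mod_cast hx
      simp [Nat.lt_one_iff.1 this]
    subst h0
    exact ((ell t).qnorm_zero).trans_lt hε
  · exact ⟨ε, hε, fun x hx => (ell_qnorm_mono hs hst x.2 _).trans_lt hx⟩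

namespace QuasiNormedSeqSpace

/-- As `ℓˢ ⊆ ℓᵗ` continuously, intersection and sum are topologically `ℓˢ` and `ℓᵗ`. -/
theorem isIntermediate_ell_iff {s t : ℝ≥0∞} (hst : s ≤ t) {X : QuasiNormedSeqSpace} :
    IsIntermediate (ell s) (ell t) X ↔
      X.IsQuasiBanach ∧ ContIncl (ell s) X ∧ ContIncl X (ell t) := by
  obtain ⟨hle, hcont⟩ := contIncl_ell hst
  refine and_congr_right fun _ => and_congr ⟨?_, ?_⟩ ⟨?_, ?_⟩
  · rintro ⟨h, h'⟩
    refine ⟨fun x hx => h ⟨hx, hle hx⟩, fun ε hε => ?_⟩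
    obtain ⟨δ, hδ, hδ'⟩ := h' ε hε
    obtain ⟨η, hη, hη'⟩ := hcont δ hδ
    exact ⟨min δ η, lt_min hδ hη, fun x hx => hδ' ⟨x, x.2, hle x.2⟩
      (max_lt (hx.trans_le (min_le_left _ _)) (hη' x (hx.trans_le (min_le_right _ _))))⟩
  · rintro ⟨h, h'⟩
    refine ⟨fun x hx => h hx.1, fun ε hε => ?_⟩
    obtain ⟨δ, hδ, hδ'⟩ := h' ε hε
    exact ⟨δ, hδ, fun x hx => hδ' ⟨x, x.2.1⟩ ((le_max_left _ _).trans_lt hx)⟩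
  · rintro ⟨h, h'⟩
    have hsum : sumCarrier (ell s) (ell t) ≤ (ell t).carrier := sup_le hle le_rfl
    refine ⟨h.trans hsum, fun ε hε => ?_⟩
    obtain ⟨C, hC1, hC⟩ := (ell t).exists_qnorm_add_le_one_le
    have hC0 : 0 < C := by linarith
    obtain ⟨η, hη, hη'⟩ := hcont (ε / (2 * C)) (by positivity)
    obtain ⟨δ, hδ, hδ'⟩ := h' (min η (ε / (2 * C))) (lt_min hη (by positivity))
    refine ⟨δ, hδ, fun x hx => ?_⟩
    have hlt := hδ' x hx
    obtain ⟨x₀, hx₀, x₁, hx₁, hxx⟩ := Submodule.mem_sup.1 (h x.2)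
    obtain ⟨c, ⟨y₀, y₁, hy, rfl⟩, hc⟩ :=
      exists_lt_of_csInf_lt (s := {c : ℝ | ∃ (y₀ : (ell s).carrier) (y₁ : (ell t).carrier),
        (x : ℕ → ℝ) = y₀ + y₁ ∧ c = (ell s).qnorm y₀ + (ell t).qnorm y₁})
        ⟨_, ⟨x₀, hx₀⟩, ⟨x₁, hx₁⟩, hxx.symm, rfl⟩ hlt
    have h0 := (ell s).qnorm_nonneg y₀
    have h1 := (ell t).qnorm_nonneg y₁
    have h2 := hη' y₀ (by linarith [min_le_left η (ε / (2 * C))])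
    have h3 : (ell t).qnorm y₁ < ε / (2 * C) := by linarith [min_le_right η (ε / (2 * C))]
    have h4 : (⟨x, hsum (h x.2)⟩ : (ell t).carrier) = ⟨y₀, hle y₀.2⟩ + y₁ := Subtype.ext hy
    rw [h4]
    refine (hC _ _).trans_lt ?_
    calc C * (_ + _) < C * (ε / (2 * C) + ε / (2 * C)) := by gcongr
      _ = ε := by field_simp; ring
  · rintro ⟨h, h'⟩
    refine ⟨h.trans le_sup_right, fun ε hε => ?_⟩
    obtain ⟨δ, hδ, hδ'⟩ := h' ε hε
    refine ⟨δ, hδ, fun x hx => lt_of_le_of_lt (csInf_le ⟨0, ?_⟩ ?_) (hδ' x hx)⟩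
    · rintro _ ⟨x₀, x₁, -, rfl⟩
      exact add_nonneg ((ell s).qnorm_nonneg _) ((ell t).qnorm_nonneg _)
    · exact ⟨0, ⟨x, h x.2⟩, by simp, by rw [(ell s).qnorm_zero, zero_add]⟩

/-- Interpolation spaces of a couple `ℓˢ ⊆ ℓᵗ`, in terms of operators on all sequences. -/
theorem mem_Int_ell_iff {s t : ℝ≥0∞} (hst : s ≤ t) {X : QuasiNormedSeqSpace} :
    X ∈ QuasiNormedSeqSpace.Int (ell s) (ell t) ↔
      (X.IsQuasiBanach ∧ ContIncl (ell s) X ∧ ContIncl X (ell t)) ∧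
      ∀ T : (ℕ → ℝ) →ₗ[ℝ] (ℕ → ℝ), (∃ C, MapsBdd T (ell s) C) → (∃ C, MapsBdd T (ell t) C) →
        ∃ C, MapsBdd T X C := by
  rw [← isIntermediate_ell_iff hst]
  refine and_congr_right fun hX => ⟨fun h T hTs hTt => ?_, fun h T hTs hTt => ?_⟩
  · have hsum : sumCarrier (ell s) (ell t) = (ell t).carrier :=
      sup_eq_right.2 (contIncl_ell hst).1
    have hT : ∀ x ∈ sumCarrier (ell s) (ell t), T x ∈ sumCarrier (ell s) (ell t) := by
      obtain ⟨C, hC⟩ := hTt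
      rw [hsum]
      exact fun x hx => (hC x hx).1
    obtain ⟨C, hC⟩ := h (T.restrict hT) (hTs.imp fun C hC x _ hx => hC x hx)
      (hTt.imp fun C hC x _ hx => hC x hx)
    exact ⟨C, fun x hx => hC x (hX.2.2.1 hx) hx⟩
  -- A purely algebraic extension suffices, since boundedness is only tested inside the sum.
  · obtain ⟨T', hT'⟩ := LinearMap.exists_extend ((sumCarrier (ell s) (ell t)).subtype ∘ₗ T)
    have hT : ∀ x hx, T' x = T ⟨x, hx⟩ := fun x hx => LinearMap.congr_fun hT' ⟨x, hx⟩
    have key : ∀ Y : QuasiNormedSeqSpace, Y.carrier ≤ sumCarrier (ell s) (ell t) → ∀ C,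
        MapsBdd T' Y C ↔ ∀ (x : ℕ → ℝ) (hV : x ∈ sumCarrier (ell s) (ell t)) (hx : x ∈ Y.carrier),
          ∃ h : (T ⟨x, hV⟩ : ℕ → ℝ) ∈ Y.carrier, Y.qnorm ⟨T ⟨x, hV⟩, h⟩ ≤ C * Y.qnorm ⟨x, hx⟩ := by
      intro Y hY C
      constructor
      · intro h x hV hx
        have := h x hx
        simpa only [hT x hV] using this
      · intro h x hx
        have := h x (hY hx) hx
        simpa only [hT x (hY hx)] using this
    obtain ⟨C, hC⟩ := h T' (hTs.imp fun C => (key _ le_sup_left C).2)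
      (hTt.imp fun C => (key _ le_sup_right C).2)
    exact ⟨C, (key X hX.2.2.1 C).1 hC⟩

end QuasiNormedSeqSpace

/-! ### Interpolation of operators and the theorem. -/

/-- An operator that is, at each point, a multiple of a sum of contractions is bounded. -/
theorem exists_mapsBdd_of_contractions {t : ℝ≥0∞} (ht : t ≠ 0) {T : (ℕ → ℝ) →ₗ[ℝ] (ℕ → ℝ)}
    {K : ℝ} (h : ∀ x ∈ (ell t).carrier, ∃ S₁ D S₂ : (ℕ → ℝ) →ₗ[ℝ] (ℕ → ℝ),
      MapsBdd S₁ (ell t) 1 ∧ MapsBdd D (ell t) 1 ∧ MapsBdd S₂ (ell t) 1 ∧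
      T x = K • (S₁ x + (D x + S₂ x))) : ∃ C, MapsBdd T (ell t) C := by
  obtain ⟨C, hC1, hC⟩ := (ell t).exists_qnorm_add_le_one_le
  refine ⟨|K| * (C * (1 + C * (1 + 1))), fun x hx => ?_⟩
  obtain ⟨S₁, D, S₂, h1, h2, h3, hT⟩ := h x hx
  obtain ⟨m1, n1⟩ := h1 x hx
  obtain ⟨m2, n2⟩ := h2 x hx
  obtain ⟨m3, n3⟩ := h3 x hx
  have hmem : T x ∈ (ell t).carrier := by
    rw [hT]
    exact Submodule.smul_mem _ _ (add_mem m1 (add_mem m2 m3))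
  refine ⟨hmem, ?_⟩
  have heq : (⟨T x, hmem⟩ : (ell t).carrier) =
      K • ((⟨S₁ x, m1⟩ : (ell t).carrier) + (⟨D x, m2⟩ + ⟨S₂ x, m3⟩)) := Subtype.ext hT
  rw [heq, ell_qnorm_smul ht, mul_assoc]
  refine mul_le_mul_of_nonneg_left ?_ (abs_nonneg _)
  refine (hC _ _).trans ?_
  have h4 := hC ⟨D x, m2⟩ ⟨S₂ x, m3⟩
  rw [one_mul] at n1 n2 n3
  have hC0 : 0 ≤ C := by linarith
  calc C * ((ell t).qnorm ⟨S₁ x, m1⟩ + (ell t).qnorm (⟨D x, m2⟩ + ⟨S₂ x, m3⟩))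
      ≤ C * ((ell t).qnorm ⟨x, hx⟩ + C * ((ell t).qnorm ⟨x, hx⟩ + (ell t).qnorm ⟨x, hx⟩)) := by
        gcongr
        exact h4.trans (by gcongr)
    _ = _ := by ring

theorem exists_contractions_of_mapsBdd {p q : ℝ≥0∞} (hp : 0 < p) (hpq : p < q) (hq : q ≠ ⊤)
    {T : (ℕ → ℝ) →ₗ[ℝ] (ℕ → ℝ)} (hTp : ∃ C, MapsBdd T (ell p) C)
    (hTq : ∃ C, MapsBdd T (ell q) C) :
    ∃ K : ℝ, ∀ x ∈ (ell q).carrier, ∃ S₁ D S₂ : (ℕ → ℝ) →ₗ[ℝ] (ℕ → ℝ),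
      (∀ t, p ≤ t → MapsBdd S₁ (ell t) 1) ∧ (∀ t, MapsBdd D (ell t) 1) ∧
      (∀ t, t ≤ q → MapsBdd S₂ (ell t) 1) ∧ T x = K • (S₁ x + (D x + S₂ x)) := by
  have hp' : p ≠ ⊤ := ne_top_of_lt hpq
  have hq0 := hp.trans hpq
  obtain ⟨C, hC⟩ := hTp
  obtain ⟨C', hC'⟩ := hTq
  obtain ⟨c, hc1, hc⟩ := hC.exists_pw_le hp hp'
  obtain ⟨d, hd1, hd⟩ := hC'.exists_pw_le hq0 hq
  obtain ⟨K, hK⟩ := exists_contractions_of_bdd (ENNReal.toReal_pos hp.ne' hp')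
    ((ENNReal.toReal_lt_toReal hp' hq).2 hpq) (by linarith) (by linarith) hc hd
  rw [ENNReal.ofReal_toReal hp', ENNReal.ofReal_toReal hq] at hK
  exact ⟨K, fun x hx => hK x ((mem_ell_iff_pw hq0 hq).1 hx)⟩

/-- Interpolation of operators between `ℓᵖ` and `ℓʳ`, `p > 0`. -/
theorem exists_mapsBdd_of_lt_of_lt {p t r : ℝ≥0∞} (hp : 0 < p) (hpt : p < t) (htr : t < r)
    {T : (ℕ → ℝ) →ₗ[ℝ] (ℕ → ℝ)} (hTp : ∃ C, MapsBdd T (ell p) C)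
    (hTr : ∃ C, MapsBdd T (ell r) C) : ∃ C, MapsBdd T (ell t) C := by
  have ht0 := hp.trans hpt
  rcases eq_or_ne r ⊤ with rfl | hr
  · have hp' : p ≠ ⊤ := ne_top_of_lt hpt
    obtain ⟨C, hC⟩ := hTp
    obtain ⟨d, hd⟩ := hTr
    obtain ⟨c, hc1, hc⟩ := hC.exists_pw_le hp hp'
    have hd' : MapsBdd T (ell ⊤) (max d 0) := fun x hx => by
      obtain ⟨h1, h2⟩ := hd x hx
      exact ⟨h1, h2.trans (mul_le_mul_of_nonneg_right (le_max_left _ _) ((ell ⊤).qnorm_nonneg _))⟩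
    obtain ⟨K, hK⟩ := exists_contraction_of_bdd_top (ENNReal.toReal_pos hp.ne' hp')
      (zero_le_one.trans hc1) (le_max_right d 0) hc (hd'.top_apply_le (le_max_right d 0))
    rw [ENNReal.ofReal_toReal hp'] at hK
    refine exists_mapsBdd_of_contractions ht0.ne' (K := K) fun x hx => ?_
    obtain ⟨S, hS, hSx⟩ := hK x
      (tendsto_zero_of_pw (ENNReal.toReal_pos ht0.ne' htr.ne) ((mem_ell_iff_pw ht0 htr.ne).1 hx))
    have h0 : MapsBdd 0 (ell t) 1 := fun y hy => ⟨zero_mem _, by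
      rw [one_mul]
      exact ((ell t).qnorm_zero).trans_le ((ell t).qnorm_nonneg _)⟩
    exact ⟨S, 0, 0, hS t hpt.le, h0, h0, by simpa using hSx⟩
  · obtain ⟨K, hK⟩ := exists_contractions_of_mapsBdd hp (hpt.trans htr) hr hTp hTr
    refine exists_mapsBdd_of_contractions ht0.ne' (K := K) fun x hx => ?_
    obtain ⟨S₁, D, S₂, h1, h2, h3, h4⟩ := hK x (Memℓp.of_exponent_ge hx htr.le)
    exact ⟨S₁, D, S₂, h1 t hpt.le, h2 t, h3 t htr.le, h4⟩

/-- An operator bounded on `ℓ⁰` and on `ℓ^q` is bounded on `ℓᵗ` for `t ≤ min 1 q`. -/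
theorem exists_mapsBdd_of_zero {q t : ℝ≥0∞} (ht0 : 0 < t) (ht1 : t ≤ 1) (htq : t ≤ q)
    (hq : q ≠ ⊤) {T : (ℕ → ℝ) →ₗ[ℝ] (ℕ → ℝ)} (hT0 : ∃ C, MapsBdd T (ell 0) C)
    (hTq : ∃ C, MapsBdd T (ell q) C) : ∃ C, MapsBdd T (ell t) C := by
  have hq0 : 0 < q := ht0.trans_le htq
  have ht : t ≠ ⊤ := ne_top_of_le_ne_top hq htq
  have htr := ENNReal.toReal_pos ht0.ne' ht
  have hqr := ENNReal.toReal_pos hq0.ne' hq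
  obtain ⟨C, hC⟩ := hT0
  obtain ⟨C', hC'⟩ := hTq
  obtain ⟨c, hc1, hc⟩ := hC'.exists_pw_le hq0 hq
  have htt : t.toReal ≤ 1 := by simpa using ENNReal.toReal_mono ENNReal.one_ne_top ht1
  set M : ℝ≥0∞ := ENNReal.ofReal C * ENNReal.ofReal c ^ (t.toReal / q.toReal) with hM
  have hMt : M ≠ ⊤ := ENNReal.mul_ne_top ENNReal.ofReal_ne_top
    (ENNReal.rpow_ne_top_of_nonneg (by positivity) ENNReal.ofReal_ne_top)
  refine ⟨_, mapsBdd_of_pw_le ht0 ht hMt fun z hz => pw_le_of_columns hqr (by linarith) htr htt hc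
    (fun j => ?_) (pw_ne_top_mono htr (ENNReal.toReal_mono hq htq) hz)⟩
  have hsupp : ({k | (Pi.single j 1 : ℕ → ℝ) k ≠ 0} : Set ℕ) = {j} := by
    ext k
    simp [Pi.single_apply]
  have hj : (Pi.single j 1 : ℕ → ℝ) ∈ (ell 0).carrier :=
    memℓp_zero (by rw [hsupp]; exact Set.finite_singleton j)
  obtain ⟨hmem, hle⟩ := hC (Pi.single j 1) hj
  rw [ell_zero_qnorm, ell_zero_qnorm, hsupp, Set.ncard_singleton, Nat.cast_one, mul_one] at hle
  have hfin : ({k | T (Pi.single j 1) k ≠ 0} : Set ℕ).Finite := memℓp_zero_iff.1 hmem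
  -- A column has at most `C` nonzero entries, by `ℓ⁰`, each bounded through `ℓ^q`.
  have hentry : ∀ k, ‖T (Pi.single j 1) k‖ₑ ^ t.toReal ≤
      ENNReal.ofReal c ^ (t.toReal / q.toReal) := by
    intro k
    have h1 := (enorm_rpow_le_pw q.toReal _ k).trans (hc (Pi.single j 1))
    rw [pw_single hqr, mul_one] at h1
    calc ‖T (Pi.single j 1) k‖ₑ ^ t.toReal
        = (‖T (Pi.single j 1) k‖ₑ ^ q.toReal) ^ (t.toReal / q.toReal) := by
          rw [← ENNReal.rpow_mul, mul_div_cancel₀ _ hqr.ne']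
      _ ≤ _ := by gcongr
  unfold pw
  rw [tsum_eq_sum (s := hfin.toFinset)]
  · refine (Finset.sum_le_card_nsmul _ _ _ fun k _ => hentry k).trans ?_
    rw [nsmul_eq_mul, hM]
    gcongr
    rw [Set.ncard_eq_toFinset_card _ hfin] at hle
    rw [← ENNReal.ofReal_natCast]
    exact ENNReal.ofReal_le_ofReal hle
  · intro k hk
    have : T (Pi.single j 1) k = 0 := by simpa using hk
    simp [this, htr]

/-- For `s = 0`, first reach some positive exponent at most 1 and below `t`, then interpolate from
there. -/
theorem exists_mapsBdd_of_lt_of_lt_of_ne_top {s t q : ℝ≥0∞} (hst : s < t) (htq : t < q)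
    (hq : q ≠ ⊤) {T : (ℕ → ℝ) →ₗ[ℝ] (ℕ → ℝ)} (hTs : ∃ C, MapsBdd T (ell s) C)
    (hTq : ∃ C, MapsBdd T (ell q) C) : ∃ C, MapsBdd T (ell t) C := by
  rcases eq_or_ne s 0 with rfl | hs
  · obtain ⟨u, hu0, hut⟩ := exists_between hst
    have hmin : 0 < min u 1 := lt_min hu0 one_pos
    have hmint : min u 1 < t := (min_le_left _ _).trans_lt hut
    exact exists_mapsBdd_of_lt_of_lt hmin hmint htq
      (exists_mapsBdd_of_zero hmin (min_le_right _ _) (hmint.trans htq).le hq hTs hTq) hTq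
  · exact exists_mapsBdd_of_lt_of_lt (pos_iff_ne_zero.2 hs) hst htq hTs hTq

/-- If `X` is continuously included in `ℓ^q`, an operator bounded on `ℓ^q` that maps `X` to `X` is
bounded on `X`. -/
theorem exists_mapsBdd_of_mapsTo {X : QuasiNormedSeqSpace} (hX : X.IsQuasiBanach) {q : ℝ≥0∞}
    (hq : q ≠ 0) (hXq : ContIncl X (ell q)) {T : (ℕ → ℝ) →ₗ[ℝ] (ℕ → ℝ)}
    (hTq : ∃ C, MapsBdd T (ell q) C) (hTX : ∀ x ∈ X.carrier, T x ∈ X.carrier) :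
    ∃ C, MapsBdd T X C := by
  obtain ⟨hle, hcont⟩ := hXq
  obtain ⟨C, hC⟩ := hTq
  -- Limits in `X` are limits in `ℓ^q`, hence coordinatewise, and `T` is continuous on `ℓ^q`; so the
  -- graph is closed.
  obtain ⟨K, hK⟩ := QuasiNormedSeqSpace.exists_qnorm_le_of_closed_graph hX (T.restrict hTX) (by
    intro u x v hu hv
    have h1 := ContIncl.tendsto (Y := ell q) (h := hle) hcont hu
    have h2 := ContIncl.tendsto (Y := ell q) (h := hle) hcont hv
    refine Subtype.ext (funext fun k => ?_)
    have h3 := (h1.const_mul C).add h2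
    rw [mul_zero, add_zero] at h3
    have h4 : ∀ n, |(v : ℕ → ℝ) k - T x k| ≤
        C * (ell q).qnorm ⟨(u n - x : X.carrier), hle (u n - x).2⟩ +
        (ell q).qnorm ⟨(T.restrict hTX (u n) - v : X.carrier),
          hle (T.restrict hTX (u n) - v).2⟩ := by
      intro n
      obtain ⟨hm, hn⟩ := hC (u n - x : X.carrier) (hle (u n - x).2)
      have h5 := (abs_apply_le_ell_qnorm hq ⟨_, hm⟩ k).trans hn
      have h6 := abs_apply_le_ell_qnorm hq ⟨(T.restrict hTX (u n) - v : X.carrier),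
          hle (T.restrict hTX (u n) - v).2⟩ k
      refine le_trans ?_ (add_le_add h5 h6)
      have h7 : T (u n - x : X.carrier) k = T (u n) k - T x k := by
        rw [Submodule.coe_sub, map_sub, Pi.sub_apply]
      have h8 : ((T.restrict hTX (u n) - v : X.carrier) : ℕ → ℝ) k = T (u n) k - (v : ℕ → ℝ) k := rfl
      change _ ≤ |T (u n - x : X.carrier) k| + |((T.restrict hTX (u n) - v : X.carrier) : ℕ → ℝ) k|
      rw [h7, h8, show (v : ℕ → ℝ) k - T x k =
        (T (u n) k - T x k) - (T (u n) k - (v : ℕ → ℝ) k) by ring]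
      exact abs_sub _ _
    have h9 : |(v : ℕ → ℝ) k - T x k| ≤ 0 := ge_of_tendsto' h3 h4
    exact sub_eq_zero.1 (abs_nonpos_iff.1 h9))
  exact ⟨K, fun x hx => ⟨hTX x hx, hK ⟨x, hx⟩⟩⟩

theorem mainTheorem1 (s p q r : ℝ≥0∞) (hsp : s < p) (hpq : p < q) (hqr : q < r) :
    QuasiNormedSeqSpace.Int (ell p) (ell q) =
      QuasiNormedSeqSpace.Int (ell s) (ell q) ∩ QuasiNormedSeqSpace.Int (ell p) (ell r) := by
  have hp0 : 0 < p := (zero_le).trans_lt hsp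
  have hq0 : 0 < q := hp0.trans hpq
  have hqt : q ≠ ⊤ := ne_top_of_lt hqr
  ext X
  rw [Set.mem_inter_iff, QuasiNormedSeqSpace.mem_Int_ell_iff hpq.le,
    QuasiNormedSeqSpace.mem_Int_ell_iff (hsp.trans hpq).le,
    QuasiNormedSeqSpace.mem_Int_ell_iff (hpq.trans hqr).le]
  constructor
  · rintro ⟨⟨hX, hpX, hXq⟩, hint⟩
    refine ⟨⟨⟨hX, (contIncl_ell hsp.le).trans hpX, hXq⟩, fun T hTs hTq => ?_⟩,
      ⟨⟨hX, hpX, hXq.trans (contIncl_ell hqr.le)⟩, fun T hTp hTr => ?_⟩⟩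
    · exact hint T (exists_mapsBdd_of_lt_of_lt_of_ne_top hsp hpq hqt hTs hTq) hTq
    · exact hint T hTp (exists_mapsBdd_of_lt_of_lt hp0 hpq hqr hTp hTr)
  · rintro ⟨⟨⟨hX, -, hXq⟩, hint₁⟩, ⟨⟨-, hpX, -⟩, hint₂⟩⟩
    refine ⟨⟨hX, hpX, hXq⟩, fun T hTp hTq => ?_⟩
    -- The operators below depend on `x`, so their bounds on `X` are not uniform: they only give `T
    -- x ∈ X`, and the closed graph theorem supplies the constant.
    refine exists_mapsBdd_of_mapsTo hX hq0.ne' hXq hTq fun x hx => ?_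
    obtain ⟨K, hK⟩ := exists_contractions_of_mapsBdd hp0 hpq hqt hTp hTq
    obtain ⟨S₁, D, S₂, h1, h2, h3, hTx⟩ := hK x (hXq.1 hx)
    obtain ⟨C₁, hC₁⟩ := hint₂ S₁ ⟨1, h1 p le_rfl⟩ ⟨1, h1 r (hpq.trans hqr).le⟩
    obtain ⟨C₂, hC₂⟩ := hint₁ D ⟨1, h2 s⟩ ⟨1, h2 q⟩
    obtain ⟨C₃, hC₃⟩ := hint₁ S₂ ⟨1, h3 s (hsp.trans hpq).le⟩ ⟨1, h3 q le_rfl⟩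
    rw [hTx]
    exact Submodule.smul_mem _ _
      (add_mem (hC₁ x hx).1 (add_mem (hC₂ x hx).1 (hC₃ x hx).1))
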